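/- All graphs are finite and simple. A matching of a graph $G$ is maximal if no other matching of $G$ properly contains it; $\nu(G)$ is the maximum size of a matching; $G$ is equimatchable if all its maximal matchings have the same size. $G$ is an ESE-graph (edge-stable equimatchable) if $G$ is equimatchable and $G\setminus e$ is equimatchable for every $e\in E(G)$. $G$ is factor-critical if $G-v$ has a perfect matching for every vertex $v$. Let $\mathcal G_1$ be the family of graphs isomorphic to $K_{2s+1}\setminus M$ for some $s\ge 3$ and some nonempty matching $M$ of $K_{2s+1}$. Let $\mathcal G_2$ be the family of graphs $G$ that have an independent set $S$ with $|S|\ge 3$ such that every vertex of $S$ is adjacent to every vertex outside $S$ and $\nu(G\setminus S)=1$, where $G\setminus S$ is the subgraph induced by $V(G)\setminus S$. **Corollary.** For every $r\ge 3$ there are, up to isomorphism, exactly $2r+2$ factor-critical ESE-graphs on $2r+1$ vertices. Each of them is $K_{2r+1}$ or belongs to $\mathcal G_1$ or $\mathcal G_2$. More precisely: - $K_{2r+1}$ is a factor-critical ESE-graph. - Up to isomorphism, exactly $r$ of these graphs belong to $\mathcal G_1$; for each $k$ with $1\le k\le r$ there is exactly one that is isomorphic to $K_{2r+1}\setminus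 M$ for a matching $M$ with $|M|=k$. - Up to isomorphism, exactly $r+1$ of these graphs belong to $\mathcal G_2$. For each of these, and each set $S$ as in the definition of $\mathcal G_2$, we have $|S|=r$, and $G\setminus S$ is the disjoint union of isolated vertices (possibly none) and either a star $K_{1,k}$ with $1\le k\le r$ or a triangle. Up to isomorphism there is exactly one such graph in which, for some such $S$, the graph $G\setminus S$ is a star $K_{1,k}$ plus isolated vertices, for each $k$ with $1\le k\le r$, and exactly one in which it is a triangle plus isolated vertices. -/

import Mathlib

namespace EdgeStable

open SimpleGraph

variable {V : Type*}

/-- `M` is a maximal matching of `G`: no matching of `G` properly contains it. -/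
def IsMaximalMatching (G : SimpleGraph V) (M : G.Subgraph) : Prop :=
  Maximal (fun N : G.Subgraph => N.IsMatching) M

/-- All maximal matchings of `G` have the same number of edges. -/
def IsEquimatchable (G : SimpleGraph V) : Prop :=
  ∀ M N : G.Subgraph, IsMaximalMatching G M → IsMaximalMatching G N →
    M.edgeSet.ncard = N.edgeSet.ncard

/-- Edge-stable equimatchable graphs (ESE-graphs). -/
def IsESE (G : SimpleGraph V) : Prop :=
  IsEquimatchable G ∧ ∀ e ∈ G.edgeSet, IsEquimatchable (G.deleteEdges {e})

/-- `G - v` has a perfect matching for every vertex `v`. -/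
def IsFactorCritical (G : SimpleGraph V) : Prop :=
  ∀ v : V, ∃ M : (G.induce ({v}ᶜ : Set V)).Subgraph, M.IsPerfectMatching

/-- The maximum number of edges in a matching (for finite graphs). -/
noncomputable def matchingNumber (G : SimpleGraph V) : ℕ :=
  sSup {n : ℕ | ∃ M : G.Subgraph, M.IsMatching ∧ M.edgeSet.ncard = n}

/-- `G` is isomorphic to `K_n` minus the edges of a matching with exactly `k` edges. -/
def IsCompleteMinusMatching (n k : ℕ) (G : SimpleGraph V) : Prop :=
  ∃ M : (⊤ : SimpleGraph (Fin n)).Subgraph, M.IsMatching ∧ M.edgeSet.ncard = k ∧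
    Nonempty (G ≃g (⊤ : SimpleGraph (Fin n)).deleteEdges M.edgeSet)

/-- The family `𝒢₁`: graphs isomorphic to `K_{2r+1} \ M` for a nonempty matching `M`, `r ≥ 3`. -/
def IsFamilyOne (G : SimpleGraph V) : Prop :=
  ∃ r k : ℕ, 3 ≤ r ∧ 1 ≤ k ∧ IsCompleteMinusMatching (2 * r + 1) k G

/-- `S` is an independent set of size at least 3 which is complete to `G \ S`, and
`ν(G \ S) = 1`. -/
structure IsFamilyTwoSet (G : SimpleGraph V) (S : Set V) : Prop where
  indep : G.IsIndepSet S
  card : 3 ≤ S.ncard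
  complete : ∀ s ∈ S, ∀ w ∉ S, G.Adj s w
  matching : matchingNumber (G.induce Sᶜ) = 1

/-- The family `𝒢₂`. -/
def IsFamilyTwo (G : SimpleGraph V) : Prop :=
  ∃ S : Set V, IsFamilyTwoSet G S

/-- `H` is the disjoint union of a star with `k` leaves and isolated vertices. -/
def IsStarPlusIsolated (k : ℕ) (H : SimpleGraph V) : Prop :=
  ∃ (c : V) (L : Finset V), c ∉ L ∧ L.card = k ∧
    ∀ u w, H.Adj u w ↔ (u = c ∧ w ∈ L) ∨ (w = c ∧ u ∈ L)

/-- `H` is the disjoint union of a triangle and isolated vertices. -/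
def IsTrianglePlusIsolated (H : SimpleGraph V) : Prop :=
  ∃ T : Finset V, T.card = 3 ∧ ∀ u w, H.Adj u w ↔ u ≠ w ∧ u ∈ T ∧ w ∈ T

/-- Graph isomorphism, as an equivalence relation on the graphs with vertex set `Fin n`. -/
def isoSetoid (n : ℕ) : Setoid (SimpleGraph (Fin n)) where
  r G H := Nonempty (G ≃g H)
  iseqv := ⟨fun _ => ⟨Iso.refl⟩, fun ⟨f⟩ => ⟨f.symm⟩, fun ⟨f⟩ ⟨g⟩ => ⟨g.comp f⟩⟩

/-- The number of isomorphism classes of graphs on `n` vertices containing a graph with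
property `P`. -/
noncomputable def numUpToIso (n : ℕ) (P : SimpleGraph (Fin n) → Prop) : ℕ :=
  (Quotient.mk (isoSetoid n) '' {G | P G}).ncard

end EdgeStable

namespace EdgeStable

open SimpleGraph

variable {V : Type*}

/-! Write n = 2r+1. If a matching of a factor-critical ESE-graph misses exactly three vertices,
those three span at least two edges. Otherwise delete the one edge `uw` they may span: the matching
becomes maximal, while a perfect matching of `G - u` survives the deletion and is larger. This is
`NoSparseRest`, and the necessity direction uses only it and factor-criticality. Conversely, if
every matching missing at least three vertices leaves two distinct edges among the missed ones, then
every maximal matching of `G` and of each `G \ e` misses one vertex, so `G` is ESE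
(`isESE_of_forall_exists`).

Suppose some `v` has two non-neighbours `u`, `w`, so that `G` is not complete minus a matching. In a
perfect matching of `G - v` with edges `u x₁` and `w x₂`, exchanges show that `v x₁ u w x₂` is an
induced pentagon or that `{x₁, x₂}` is independent and complete to `{v, u, w}`. A pentagon is
refuted with one further matching edge, which exists because n ≥ 7 (`pentagon_false`). The other
case is a split (`IsSplit`): `P` independent, complete to `Q`, `|Q| = |P| + 1`, the remaining
vertices perfectly matched. `IsSplit.step` absorbs the remaining matching edges one at a time,
possibly exchanging the two sides, until `P ∪ Q` is everything. Factor-criticality then puts an edge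
inside `Q`, and two disjoint edges there would allow a matching that misses three vertices of `P`.
So `ν(Q) = 1`, and `Q` induces a star or a triangle plus isolated vertices.

For the count, each candidate class is described by a colouring that determines adjacency, so colour
class sizes give uniqueness up to isomorphism. Edge numbers separate complete graphs minus matchings
of different sizes, an independent triple separates these from the joins, and degrees separate the
joins from each other. -/

/-! ### Matchings as lists of consecutive pairs -/

/-- The list `l` splits into consecutive pairs of adjacent vertices of `G`. -/
def IsPairing (G : SimpleGraph V) : List V → Prop
  | [] => True
  | [_] => False
  | u :: w :: l => G.Adj u w ∧ IsPairing G l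

theorem IsPairing.append {G : SimpleGraph V} : ∀ {l m : List V},
    IsPairing G l → IsPairing G m → IsPairing G (l ++ m)
  | [], _, _, hm => hm
  | [_], _, hl, _ => hl.elim
  | _ :: _ :: _, _, hl, hm => ⟨hl.1, IsPairing.append hl.2 hm⟩

theorem IsPairing.mono {G H : SimpleGraph V} (h : G ≤ H) : ∀ {l : List V},
    IsPairing G l → IsPairing H l
  | [], _ => trivial
  | [_], hl => hl.elim
  | _ :: _ :: _, hl => ⟨h hl.1, IsPairing.mono h hl.2⟩

theorem IsPairing.even_length {G : SimpleGraph V} : ∀ {l : List V},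
    IsPairing G l → Even l.length
  | [], _ => by simp
  | [_], hl => hl.elim
  | _ :: _ :: _, hl => by
    have := IsPairing.even_length hl.2
    simp only [List.length_cons]
    grind

theorem exists_isMatching_of_isPairing {G : SimpleGraph V} : ∀ {l : List V},
    IsPairing G l → l.Nodup → ∃ M : G.Subgraph, M.IsMatching ∧ M.verts = {x | x ∈ l}
  | [], _, _ => ⟨⊥, fun v hv => hv.elim, by simp⟩
  | [_], hl, _ => hl.elim
  | u :: w :: l, hl, hn => by
    obtain ⟨M, hM, hMv⟩ := exists_isMatching_of_isPairing hl.2 (by simp_all)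
    refine ⟨G.subgraphOfAdj hl.1 ⊔ M, (Subgraph.IsMatching.subgraphOfAdj hl.1).sup hM ?_, ?_⟩
    · rw [hM.support_eq_verts, (Subgraph.IsMatching.subgraphOfAdj hl.1).support_eq_verts, hMv,
        Set.disjoint_left]
      intro x hx hx'
      simp only [subgraphOfAdj_verts, Set.mem_insert_iff, Set.mem_singleton_iff] at hx
      simp only [List.nodup_cons, List.mem_cons, Set.mem_ofPred_eq] at hn hx'
      rcases hx with rfl | rfl <;> simp_all
    · ext x
      simp [hMv, or_assoc]

theorem IsMatching.deleteVerts_pair {G : SimpleGraph V} {M : G.Subgraph} (hM : M.IsMatching)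
    {u w : V} (h : M.Adj u w) : (M.deleteVerts {u, w}).IsMatching := by
  intro x hx
  simp only [Subgraph.deleteVerts_verts, Set.mem_sdiff, Set.mem_insert_iff,
    Set.mem_singleton_iff, not_or] at hx
  obtain ⟨y, hy, hy'⟩ := hM hx.1
  refine ⟨y, ?_, fun z hz => hy' z (by simp at hz; tauto)⟩
  have h1 : y ≠ u := by rintro rfl; exact hx.2.2 (hM.eq_of_adj_left hy.symm h)
  have h2 : y ≠ w := by rintro rfl; exact hx.2.1 (hM.eq_of_adj_left hy.symm h.symm)
  simp [hx, hy, h1, h2, M.edge_vert hy.symm]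

theorem exists_isPairing_of_isMatching [Finite V] {G : SimpleGraph V} {M : G.Subgraph}
    (hM : M.IsMatching) : ∃ l, IsPairing G l ∧ l.Nodup ∧ ∀ x, x ∈ l ↔ x ∈ M.verts := by
  induction hn : M.verts.ncard using Nat.strong_induction_on generalizing M with
  | _ n ih =>
    rcases M.verts.eq_empty_or_nonempty with h | ⟨u, hu⟩
    · exact ⟨[], trivial, by simp, by simp [h]⟩
    · obtain ⟨w, hw, -⟩ := hM hu
      obtain ⟨l, hl, hl', hlm⟩ := ih _ (by
        rw [← hn]
        exact Set.ncard_lt_ncard (s := (M.deleteVerts {u, w}).verts)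
          ⟨by simp, fun h => by simpa using h hu⟩ (Set.toFinite _))
        (IsMatching.deleteVerts_pair hM hw) rfl
      refine ⟨u :: w :: l, ⟨M.adj_sub hw, hl⟩, ?_, ?_⟩
      · simp [hl', hlm, (M.adj_sub hw).ne]
      · intro x
        have := M.edge_vert hw.symm
        simp only [List.mem_cons, hlm, Subgraph.deleteVerts_verts, Set.mem_sdiff,
          Set.mem_insert_iff, Set.mem_singleton_iff, not_or]
        grind

theorem two_mul_ncard_edgeSet [Finite V] {G : SimpleGraph V} {M : G.Subgraph}
    (hM : M.IsMatching) : 2 * M.edgeSet.ncard = M.verts.ncard := by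
  classical
  have := Fintype.ofFinite V
  have h1 : M.edgeSet.ncard = M.coe.edgeFinset.card := by
    rw [← Set.ncard_coe_finset, coe_edgeFinset, ← Subgraph.image_coe_edgeSet_coe,
      Set.ncard_image_of_injective]
    exact Sym2.map.injective Subtype.val_injective
  rw [Subgraph.isMatching_iff_forall_degree] at hM
  rw [h1, ← M.coe.sum_degrees_eq_twice_card_edges]
  rw [Finset.sum_congr rfl (g := fun _ => 1) fun x _ => by
    rw [M.coe_degree]
    convert hM x x.2]
  simp [Set.ncard_eq_toFinset_card', Fintype.card_subtype]

theorem isFactorCritical_iff [Finite V] {G : SimpleGraph V} : IsFactorCritical G ↔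
    ∀ v, ∃ l, IsPairing G l ∧ (v :: l).Nodup ∧ ∀ x, x ∈ v :: l := by
  refine forall_congr' fun v => ⟨?_, ?_⟩
  · rintro ⟨M, hM, hs⟩
    obtain ⟨l, hl, hn, hm⟩ := exists_isPairing_of_isMatching
      (hM.map (Embedding.induce (G := G) ({v}ᶜ : Set V)).toHom Subtype.val_injective)
    have hm' : ∀ x, x ∈ l ↔ x ≠ v := by
      intro x
      rw [hm]
      simp only [Subgraph.map_verts, Set.mem_image]
      constructor
      · rintro ⟨y, -, rfl⟩
        exact y.2
      · intro hx
        exact ⟨⟨x, hx⟩, hs _, rfl⟩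
    exact ⟨l, hl, by simp [hn, hm'], fun x => by simp [hm', em]⟩
  · rintro ⟨l, hl, hn, hm⟩
    have hm' : ∀ x, x ∈ l ↔ x ≠ v := by
      intro x
      have := hm x
      simp only [List.nodup_cons, List.mem_cons] at hn this
      grind
    obtain ⟨M, hM, hMv⟩ := exists_isMatching_of_isPairing hl (by simp_all)
    refine ⟨{ verts := Set.univ
              Adj := fun a b => M.Adj a b
              adj_sub := fun h => M.adj_sub h
              edge_vert := fun _ => trivial
              symm := ⟨fun a b h => M.adj_symm h⟩ }, ?_, fun _ => trivial⟩
    intro a _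
    obtain ⟨b, hb, hb'⟩ := hM (v := a) (by rw [hMv]; exact (hm' _).2 a.2)
    have : b ∈ M.verts := M.edge_vert hb.symm
    rw [hMv] at this
    exact ⟨⟨b, (hm' b).1 this⟩, hb, fun c hc => Subtype.ext (hb' _ hc)⟩

theorem bddAbove_matching [Finite V] (G : SimpleGraph V) :
    BddAbove {n : ℕ | ∃ M : G.Subgraph, M.IsMatching ∧ M.edgeSet.ncard = n} :=
  ⟨Nat.card V, by
    rintro n ⟨M, hM, rfl⟩
    have := two_mul_ncard_edgeSet hM
    have := Set.ncard_le_card M.verts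
    omega⟩

/-! ### Graphs of matching number one -/

/-- Matching number one means that there is an edge, but no two disjoint ones. -/
theorem matchingNumber_eq_one_iff [Finite V] {G : SimpleGraph V} : matchingNumber G = 1 ↔
    (∃ u w, G.Adj u w) ∧ ∀ a b c d, G.Adj a b → G.Adj c d → ¬ [a, b, c, d].Nodup := by
  constructor
  · intro h
    constructor
    · have := Nat.sSup_mem (s := {n : ℕ | ∃ M : G.Subgraph, M.IsMatching ∧ M.edgeSet.ncard = n})
        ⟨_, ⊥, fun v hv => hv.elim, rfl⟩ (bddAbove_matching G)
      obtain ⟨M, -, h1⟩ := this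
      rw [show sSup _ = 1 from h, Set.ncard_eq_one] at h1
      obtain ⟨e, he⟩ := h1
      have : e ∈ M.edgeSet := by simp [he]
      induction e with
      | _ u w => exact ⟨u, w, M.adj_sub this⟩
    · intro a b c d hab hcd hn
      obtain ⟨M, hM, hMv⟩ := exists_isMatching_of_isPairing (l := [a, b, c, d])
        ⟨hab, hcd, trivial⟩ hn
      have h1 := two_mul_ncard_edgeSet hM
      have h2 : M.edgeSet.ncard ≤ matchingNumber G :=
        le_csSup (bddAbove_matching G) ⟨M, hM, rfl⟩
      classical
      rw [hMv, show {x | x ∈ [a, b, c, d]} = (([a, b, c, d].toFinset : Finset V) : Set V) by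
        ext; simp, Set.ncard_coe_finset, List.toFinset_card_of_nodup hn] at h1
      simp at h1
      omega
  · rintro ⟨⟨u, w, huw⟩, h⟩
    apply le_antisymm
    · refine csSup_le ⟨_, ⊥, fun v hv => hv.elim, rfl⟩ ?_
      rintro _ ⟨M, hM, rfl⟩
      rw [Set.ncard_le_one_iff_eq]
      by_contra! hc
      obtain ⟨e, he⟩ := hc.1
      induction e with
      | _ a b =>
        obtain ⟨f, hf, hne⟩ : ∃ f ∈ M.edgeSet, f ≠ s(a, b) := by
          by_contra! h'
          exact hc.2 s(a, b) (Set.eq_singleton_iff_unique_mem.2 ⟨he, h'⟩)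
        induction f with
        | _ c d =>
          have he' : M.Adj a b := he
          have hf' : M.Adj c d := hf
          refine h a b c d (M.adj_sub he) (M.adj_sub hf) ?_
          have h1 := he'.ne
          have h2 := hf'.ne
          have h3 : a ≠ c := by
            rintro rfl; exact hne (by rw [hM.eq_of_adj_left he' hf'])
          have h4 : a ≠ d := by
            rintro rfl; exact hne (by rw [hM.eq_of_adj_left he' hf'.symm, Sym2.eq_swap])
          have h5 : b ≠ c := by
            rintro rfl; exact hne (by rw [hM.eq_of_adj_left he'.symm hf', Sym2.eq_swap])
          have h6 : b ≠ d := by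
            rintro rfl; exact hne (by rw [hM.eq_of_adj_left he'.symm hf'.symm])
          simp_all
    · exact le_csSup (bddAbove_matching G) ⟨G.subgraphOfAdj huw, .subgraphOfAdj huw, by simp⟩

/-! ### Sparse triples, splits and the exchange argument -/

/-- At most one of the three pairs from `a`, `b`, `c` is an edge of `G`. -/
def IsSparse (G : SimpleGraph V) (a b c : V) : Prop :=
  (¬ G.Adj a b ∧ ¬ G.Adj a c) ∨ (¬ G.Adj a b ∧ ¬ G.Adj b c) ∨ (¬ G.Adj a c ∧ ¬ G.Adj b c)

/-- A matching that misses exactly three vertices never misses a sparse triple. -/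
def NoSparseRest (G : SimpleGraph V) : Prop :=
  ∀ a b c l, (a :: b :: c :: l).Nodup → (∀ x, x ∈ a :: b :: c :: l) → IsPairing G l →
    ¬ IsSparse G a b c

/-- `P` is an independent set that is complete to the set `Q`, which has one vertex more and
contains a sparse triple; the list `R` is a matching of the remaining vertices. -/
structure IsSplit (G : SimpleGraph V) (P Q : Finset V) (R : List V) : Prop where
  indep : ∀ x ∈ P, ∀ y ∈ P, ¬ G.Adj x y
  complete : ∀ x ∈ P, ∀ q ∈ Q, G.Adj x q
  card_eq : Q.card = P.card + 1
  two_le : 2 ≤ P.card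
  nodup : R.Nodup
  notMem_left : ∀ x ∈ R, x ∉ P
  notMem_right : ∀ x ∈ R, x ∉ Q
  cover : ∀ x, x ∈ P ∨ x ∈ Q ∨ x ∈ R
  pairing : IsPairing G R
  sparse : ∃ t₁ ∈ Q, ∃ t₂ ∈ Q, ∃ t₃ ∈ Q, [t₁, t₂, t₃].Nodup ∧ IsSparse G t₁ t₂ t₃

theorem exists_isPairing_of_card_eq [Finite V] {G : SimpleGraph V} {P Q : Finset V}
    (h : ∀ x ∈ P, ∀ q ∈ Q, G.Adj x q) (hc : P.card = Q.card) :
    ∃ l, IsPairing G l ∧ l.Nodup ∧ ∀ x, x ∈ l ↔ x ∈ P ∨ x ∈ Q := by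
  have hd : Disjoint (P : Set V) (Q : Set V) :=
    Set.disjoint_left.2 fun x hx hx' => (h x hx x hx').ne rfl
  obtain ⟨M, hMv, hM⟩ := Subgraph.IsMatching.exists_of_disjoint_sets_of_equiv (G := G) hd
    (Finset.equivOfCardEq hc) fun v => h _ v.2 _ (Finset.equivOfCardEq hc v).2
  obtain ⟨l, hl, hn, hm⟩ := exists_isPairing_of_isMatching hM
  exact ⟨l, hl, hn, fun x => by simp [hm, hMv]⟩

theorem perm_of_subset {l m : List V} (hm : m.Nodup) (h : ∀ x ∈ m, x ∈ l)
    (hlen : l.length = m.length) : l.Perm m :=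
  ((List.subperm_of_subset hm h).perm_of_length_le hlen.le).symm

theorem exists_mem_ne_ne {Q : Finset V} (h : 3 ≤ Q.card) (u w : V) :
    ∃ t ∈ Q, t ≠ u ∧ t ≠ w := by
  classical
  by_contra! hc
  have := Finset.card_le_card (show Q ⊆ {u, w} by intro t ht; have := hc t ht; grind)
  have := Finset.card_le_two (a := u) (b := w)
  omega

theorem IsSplit.swap {G : SimpleGraph V} {P Q : Finset V} {a b : V} {R : List V}
    (h : IsSplit G P Q (a :: b :: R)) : IsSplit G P Q (b :: a :: R) where
  indep := h.indep
  complete := h.complete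
  card_eq := h.card_eq
  two_le := h.two_le
  nodup := by have := h.nodup; grind
  notMem_left := fun x hx => h.notMem_left x (by grind)
  notMem_right := fun x hx => h.notMem_right x (by grind)
  cover := fun x => by have := h.cover x; grind
  pairing := ⟨h.pairing.1.symm, h.pairing.2⟩
  sparse := h.sparse

theorem IsSplit.disjoint {G : SimpleGraph V} {P Q : Finset V} {R : List V}
    (h : IsSplit G P Q R) {x : V} (hx : x ∈ P) : x ∉ Q :=
  fun hx' => (h.complete x hx x hx').ne rfl

/-- Exchange argument: a matching of some vertices of `P`, `Q` and `{a, b}` missing three of them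
extends to the whole graph. -/
theorem IsSplit.not_isSparse [Finite V] {G : SimpleGraph V} (hG : NoSparseRest G)
    {P Q : Finset V} {a b : V} {R : List V} (h : IsSplit G P Q (a :: b :: R))
    (A B : List V) (t₁ t₂ t₃ : V) (E : List V) (hA : A.Nodup) (hB : B.Nodup)
    (hAP : ∀ x ∈ A, x ∈ P) (hBQ : ∀ x ∈ B, x ∈ Q) (hAB : B.length = A.length + 1)
    (hsub : ∀ z ∈ a :: b :: (A ++ B), z ∈ t₁ :: t₂ :: t₃ :: E)
    (hlen : E.length = 2 * A.length) (hE : IsPairing G E) : ¬ IsSparse G t₁ t₂ t₃ := by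
  classical
  have hA' : A.toFinset ⊆ P := fun x hx => hAP x (by simpa using hx)
  have hB' : B.toFinset ⊆ Q := fun x hx => hBQ x (by simpa using hx)
  -- What is left of `P` and `Q` has equal size and is completely joined, so it can be matched
  -- arbitrarily; only `a`, `b`, `A`, `B` need a prescribed matching.
  obtain ⟨Z, hZ, hZn, hZm⟩ := exists_isPairing_of_card_eq (G := G) (P := P \ A.toFinset)
    (Q := Q \ B.toFinset)
    (fun x hx q hq => h.complete x (Finset.mem_sdiff.1 hx).1 q (Finset.mem_sdiff.1 hq).1) (by
      rw [Finset.card_sdiff_of_subset hA', Finset.card_sdiff_of_subset hB',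
        List.toFinset_card_of_nodup hA, List.toFinset_card_of_nodup hB, h.card_eq, hAB]
      omega)
  have hn := h.nodup
  have hl := h.notMem_left
  have hr := h.notMem_right
  have hd := fun x (hx : x ∈ P) => h.disjoint hx
  simp only [List.nodup_cons, List.mem_cons, not_or] at hn hl hr
  have hnd : (a :: b :: (A ++ B)).Nodup := by
    simp only [List.nodup_cons, List.nodup_append, List.mem_cons, List.mem_append]
    grind
  have hperm := perm_of_subset hnd hsub (by simp [hlen, hAB]; omega)
  have hfull : (a :: b :: (A ++ B) ++ (Z ++ R)).Nodup := by
    rw [List.nodup_append]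
    refine ⟨hnd, ?_, ?_⟩
    · rw [List.nodup_append]
      exact ⟨hZn, hn.2.2, by grind⟩
    · simp only [List.mem_cons, List.mem_append, hZm, Finset.mem_sdiff, List.mem_toFinset]
      grind
  have hperm' := hperm.append_right (Z ++ R)
  refine hG t₁ t₂ t₃ (E ++ (Z ++ R)) (hperm'.nodup_iff.2 hfull) (fun x => ?_)
    (hE.append (hZ.append h.pairing.2))
  refine hperm'.mem_iff.2 ?_
  have := h.cover x
  simp only [List.mem_cons, List.mem_append, hZm, Finset.mem_sdiff, List.mem_toFinset] at this ⊢
  tauto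

/-! ### Absorbing one matching edge into a split -/

/-- Here `a` joins `Q \ {q}` to form the new independent side, and `q`, `b` join `P` on the other.
Each adjacency needed comes from a matching that leaves three chosen vertices, two of which are
known to be non-adjacent. -/
theorem IsSplit.step_of_adj [Finite V] {G : SimpleGraph V} (hG : NoSparseRest G)
    {P Q : Finset V} {a b : V} {R : List V} (h : IsSplit G P Q (a :: b :: R)) {q x : V}
    (hq : q ∈ Q) (hqa : G.Adj q a) (hqb : ¬ G.Adj q b) (hx : x ∈ P) (hax : G.Adj a x) :
    ∃ P' Q', IsSplit G P' Q' R := by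
  classical
  have key := h.not_isSparse hG
  obtain ⟨t₁, ht₁, t₂, ht₂, t₃, ht₃, htn, hts⟩ := h.sparse
  have hin := h.indep
  -- With `ax` matched, `q`, `b`, `q'` are left over; `qb` is a non-edge, so the other two pairs are
  -- edges.
  have f₁ : ∀ q' ∈ Q, q' ≠ q → G.Adj q q' ∧ G.Adj b q' := by
    intro q' hq' hne
    have := key [x] [q, q'] q b q' [a, x] (by simp) (by simp [hne.symm]) (by simp [hx])
      (by simp [hq, hq']) (by simp) (by simp) (by simp) ⟨hax, trivial⟩
    simp only [IsSparse] at this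
    tauto
  -- By `f₁`, `q` is adjacent to the rest of `Q`, so a triple containing `q` spans two edges.
  have hqt : q ≠ t₁ ∧ q ≠ t₂ ∧ q ≠ t₃ := by
    simp only [IsSparse, List.nodup_cons, List.mem_cons] at hts htn
    refine ⟨?_, ?_, ?_⟩ <;> rintro rfl <;> grind [SimpleGraph.adj_comm]
  simp only [List.nodup_cons, List.mem_cons, List.not_mem_nil, or_false, not_or] at htn
  have f₃ : ∀ x' ∈ P, G.Adj a x' := by
    intro x' hx'
    rcases eq_or_ne x x' with rfl | hne
    · exact hax
    have := key [x, x'] [t₁, t₂, q] a x x' [q, t₁, b, t₂] (by simp [hne]) (by grind) (by simp [*])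
      (by simp [*]) (by simp) (by simp) (by simp)
      ⟨(f₁ t₁ ht₁ hqt.1.symm).1, (f₁ t₂ ht₂ hqt.2.1.symm).2, trivial⟩
    have := hin x hx x' hx'
    simp only [IsSparse] at *
    tauto
  have hother : ∀ x' ∈ P, ∃ y ∈ P, y ≠ x' := fun x' hx' => by
    obtain ⟨y, hy, hne⟩ := Finset.exists_mem_ne (s := P) (by have := h.two_le; omega) x'
    exact ⟨y, hy, hne⟩
  have f₄ : ∀ x' ∈ P, ¬ G.Adj b x' := by
    intro x' hx' hbx
    obtain ⟨y, hy, hne⟩ := hother x' hx'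
    exact key [y, x'] [t₁, t₂, t₃] t₁ t₂ t₃ [a, y, b, x'] (by simp [hne]) (by grind) (by simp [*])
      (by simp [*]) (by simp) (by simp) (by simp) ⟨f₃ y hy, hbx, trivial⟩ hts
  have f₅ : ∀ q' ∈ Q, q' ≠ q → ¬ G.Adj a q' := by
    intro q' hq' hne haq
    obtain ⟨t, ht, htq, htq'⟩ : ∃ t ∈ Q, t ≠ q ∧ t ≠ q' := by
      by_cases h1 : t₁ = q'
      · exact ⟨t₂, ht₂, hqt.2.1.symm, fun h2 => htn.1.1 (h1.trans h2.symm)⟩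
      · exact ⟨t₁, ht₁, hqt.1.symm, h1⟩
    obtain ⟨y, hy, hyx⟩ := hother x hx
    refine key [x, y] [q, t, q'] b x y [q, t, a, q'] (by simp [hyx.symm]) (by grind) (by simp [*])
      (by simp [*]) (by simp) (by simp) (by simp) ⟨(f₁ t ht htq).1, haq, trivial⟩ ?_
    exact Or.inl ⟨f₄ x hx, f₄ y hy⟩
  -- The sparse triple and `q` are four vertices of `Q`, so `P` has at least three; `f₆` spends one
  -- of them on `a` and leaves two with `b`.
  have hQ4 : 4 ≤ Q.card := by
    have hsub : [q, t₁, t₂, t₃].toFinset ⊆ Q := by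
      simp [Finset.insert_subset_iff, *]
    have := Finset.card_le_card hsub
    rwa [List.toFinset_card_of_nodup (by simp [*])] at this
  obtain ⟨x₁, x₂, x₃, hx₁, hx₂, hx₃, h12, h13, h23⟩ :=
    Finset.two_lt_card_iff.1 (show 2 < P.card by have := h.card_eq; omega)
  have f₆ : ∀ u ∈ Q, u ≠ q → ∀ w ∈ Q, w ≠ q → ¬ G.Adj u w := by
    intro u hu huq w hw hwq huw
    obtain ⟨t, ht, htu, htw⟩ := exists_mem_ne_ne (Q := Q.erase q)
      (by rw [Finset.card_erase_of_mem hq]; omega) u w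
    obtain ⟨htq, ht⟩ := Finset.mem_erase.1 ht
    have huw' := huw.ne
    refine key [x₁, x₂, x₃] [q, t, u, w] b x₂ x₃ [a, x₁, q, t, u, w] (by simp [*]) (by grind)
      (by simp [*]) (by simp [*]) (by simp) (by simp) (by simp)
      ⟨f₃ x₁ hx₁, (f₁ t ht htq).1, huw, trivial⟩ ?_
    exact Or.inl ⟨f₄ x₂ hx₂, f₄ x₃ hx₃⟩
  have hl := h.notMem_left
  have hr := h.notMem_right
  have hn := h.nodup
  have hd := fun x (hx : x ∈ P) => h.disjoint hx
  have hab := h.pairing.1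
  simp only [List.nodup_cons, List.mem_cons, not_or] at hn hl hr
  have hqP : q ∉ P := fun hq' => hd q hq' hq
  have hc := h.card_eq
  have hcomp := h.complete
  refine ⟨insert a (Q.erase q), insert q (insert b P), ?_, ?_, ?_, ?_, hn.2.2, ?_, ?_, ?_,
    h.pairing.2, b, by simp, x₁, by simp [hx₁], x₂, by simp [hx₂], ?_,
    Or.inl ⟨f₄ x₁ hx₁, f₄ x₂ hx₂⟩⟩
  · simp only [Finset.mem_insert, Finset.mem_erase]
    rintro u (rfl | ⟨hu, hu'⟩) w (rfl | ⟨hw, hw'⟩)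
    · exact G.loopless.irrefl _
    · exact f₅ w hw' hw
    · exact fun h => f₅ u hu' hu h.symm
    · exact f₆ u hu' hu w hw' hw
  · simp only [Finset.mem_insert, Finset.mem_erase]
    rintro u (rfl | ⟨hu, hu'⟩) w (rfl | rfl | hw)
    · exact hqa.symm
    · exact hab
    · exact f₃ w hw
    · exact (f₁ u hu' hu).1.symm
    · exact (f₁ u hu' hu).2.symm
    · exact (hcomp w hw u hu').symm
  · rw [Finset.card_insert_of_notMem (by grind), Finset.card_insert_of_notMem (by grind),
      Finset.card_insert_of_notMem (by grind), Finset.card_erase_of_mem hq]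
    omega
  · rw [Finset.card_insert_of_notMem (by grind), Finset.card_erase_of_mem hq]
    omega
  · grind
  · grind
  · intro z
    have := h.cover z
    grind
  · grind

/-- When `a` has no neighbour in `P`, it can simply join `P`, with `b` joining `Q`, provided that
`a` is complete to `Q` and `b` to `P`. If `a` misses a vertex of `Q`, the previous case applies with
`a` and `b` exchanged. -/
theorem IsSplit.step_of_adj_of_not_adj [Finite V] {G : SimpleGraph V} (hG : NoSparseRest G)
    {P Q : Finset V} {a b : V} {R : List V} (h : IsSplit G P Q (a :: b :: R)) {q : V}
    (hq : q ∈ Q) (hqa : G.Adj q a) (hqb : ¬ G.Adj q b) : ∃ P' Q', IsSplit G P' Q' R := by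
  classical
  by_cases hx : ∃ x ∈ P, G.Adj a x
  · obtain ⟨x, hx, hax⟩ := hx
    exact h.step_of_adj hG hq hqa hqb hx hax
  push Not at hx
  have key := h.not_isSparse hG
  have hin := h.indep
  have hc := h.card_eq
  have h2 := h.two_le
  have hcov : ∀ q' ∈ Q, G.Adj q' a ∨ G.Adj q' b := by
    intro q' hq'
    have := key [] [q'] q' a b [] (by simp) (by simp) (by simp) (by simp [*]) (by simp) (by simp)
      (by simp) trivial
    simp only [IsSparse] at this
    tauto
  -- A non-neighbour `x₀` of `b` would make `b` complete and `a` anticomplete to `Q \ {q}`; matching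
  -- `b` into it then leaves `a` with two non-neighbours.
  have hb : ∀ x ∈ P, G.Adj b x := by
    intro x₀ hx₀
    by_contra hbx
    have f₁ : ∀ q' ∈ Q, q' ≠ q → G.Adj b q' := by
      intro q' hq' hne
      have := key [x₀] [q, q'] b q' x₀ [a, q] (by simp) (by simp [hne.symm]) (by simp [*])
        (by simp [*]) (by simp) (by simp) (by simp) ⟨hqa.symm, trivial⟩
      simp only [IsSparse] at this
      tauto
    have f₂ : ∀ q' ∈ Q, q' ≠ q → ¬ G.Adj a q' := by
      intro q' hq' hne haq
      refine key [x₀] [q, q'] b x₀ q [a, q'] (by simp) (by simp [hne.symm]) (by simp [*])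
        (by simp [*]) (by simp) (by simp) (by simp) ⟨haq, trivial⟩ (Or.inl ⟨hbx, ?_⟩)
      exact fun h => hqb h.symm
    obtain ⟨u, w, hu, hw, huw⟩ : ∃ u w, u ∈ Q.erase q ∧ w ∈ Q.erase q ∧ u ≠ w := by
      rw [← Finset.one_lt_card_iff, Finset.card_erase_of_mem hq]
      omega
    rw [Finset.mem_erase] at hu hw
    exact key [x₀] [u, w] a w x₀ [b, u] (by simp) (by simp [*]) (by simp [*])
        (by simp [*]) (by simp) (by simp) (by simp) ⟨f₁ u hu.2 hu.1, trivial⟩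
        (Or.inl ⟨f₂ w hw.2 hw.1, hx x₀ hx₀⟩)
  obtain ⟨x, hxP⟩ : P.Nonempty := Finset.card_pos.1 (by omega)
  by_cases ha : ∃ q' ∈ Q, ¬ G.Adj q' a
  · obtain ⟨q', hq', hqa'⟩ := ha
    exact h.swap.step_of_adj hG hq' ((hcov q' hq').resolve_left hqa') hqa' hxP (hb x hxP)
  push Not at ha
  have hl := h.notMem_left
  have hr := h.notMem_right
  have hn := h.nodup
  have hd := fun x (hx : x ∈ P) => h.disjoint hx
  have hab := h.pairing.1
  have hcomp := h.complete
  simp only [List.nodup_cons, List.mem_cons, not_or] at hn hl hr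
  obtain ⟨t₁, ht₁, t₂, ht₂, t₃, ht₃, hts⟩ := h.sparse
  refine ⟨insert a P, insert b Q, ?_, ?_, ?_, ?_, hn.2.2, ?_, ?_, ?_,
    h.pairing.2, t₁, by simp [*], t₂, by simp [*], t₃, by simp [*], hts⟩
  · simp only [Finset.mem_insert]
    rintro u (rfl | hu) w (rfl | hw)
    · exact G.loopless.irrefl _
    · exact hx w hw
    · exact fun h => hx u hu h.symm
    · exact hin u hu w hw
  · simp only [Finset.mem_insert]
    rintro u (rfl | hu) w (rfl | hw)
    · exact hab
    · exact (ha w hw).symm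
    · exact (hb u hu).symm
    · exact hcomp u hu w hw
  · rw [Finset.card_insert_of_notMem (by grind), Finset.card_insert_of_notMem (by grind)]
    omega
  · rw [Finset.card_insert_of_notMem (by grind)]
    omega
  · grind
  · grind
  · intro z
    have := h.cover z
    grind

/-- In the remaining case `a` and `b` are both complete to `Q`, and the sides trade roles: `Q` turns
out independent, and `P ∪ {a, b}` is the new larger side. -/
theorem IsSplit.step [Finite V] {G : SimpleGraph V} (hG : NoSparseRest G)
    {P Q : Finset V} {a b : V} {R : List V} (h : IsSplit G P Q (a :: b :: R)) :
    ∃ P' Q', IsSplit G P' Q' R := by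
  classical
  have key := h.not_isSparse hG
  have hin := h.indep
  have hc := h.card_eq
  have h2 := h.two_le
  obtain ⟨t₁, ht₁, t₂, ht₂, t₃, ht₃, htn, hts⟩ := h.sparse
  have hcov : ∀ q' ∈ Q, G.Adj q' a ∨ G.Adj q' b := by
    intro q' hq'
    have := key [] [q'] q' a b [] (by simp) (by simp) (by simp) (by simp [*]) (by simp) (by simp)
      (by simp) trivial
    simp only [IsSparse] at this
    tauto
  by_cases hboth : ∀ q ∈ Q, G.Adj q a ∧ G.Adj q b
  swap
  · push Not at hboth
    obtain ⟨q, hq, hq'⟩ := hboth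
    by_cases hqa : G.Adj q a
    · exact h.step_of_adj_of_not_adj hG hq hqa (hq' hqa)
    · exact h.swap.step_of_adj_of_not_adj hG hq ((hcov q hq).resolve_left hqa) hqa
  have f₁ : ∀ x ∈ P, ∀ y ∈ P, x ≠ y → G.Adj a x → ¬ G.Adj b y := by
    intro x hx y hy hne hax hby
    exact key [x, y] [t₁, t₂, t₃] t₁ t₂ t₃ [a, x, b, y] (by simp [hne]) htn (by simp [*])
      (by simp [*]) (by simp) (by simp) (by simp) ⟨hax, hby, trivial⟩ hts
  obtain ⟨x, y, hx, hy, hxy⟩ := Finset.one_lt_card_iff.1 (show 1 < P.card by omega)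
  -- Matching `uw` together with `at` leaves `b`, `x`, `y`, and with `bt` it leaves `a`, `x`, `y`.
  -- As `xy` is a non-edge, `a` and `b` are both adjacent to `x` and `y`, against `f₁`.
  have f₂ : ∀ u ∈ Q, ∀ w ∈ Q, ¬ G.Adj u w := by
    intro u hu w hw huw
    have huw' := huw.ne
    obtain ⟨t, ht, htu, htw⟩ := exists_mem_ne_ne (Q := Q) (by omega) u w
    have hxy' := hin x hx y hy
    have h1 := key [x, y] [u, w, t] b x y [u, w, a, t] (by simp [hxy]) (by grind) (by simp [*])
      (by simp [*]) (by simp) (by simp) (by simp) ⟨huw, (hboth t ht).1.symm, trivial⟩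
    have h2 := key [x, y] [u, w, t] a x y [u, w, b, t] (by simp [hxy]) (by grind) (by simp [*])
      (by simp [*]) (by simp) (by simp) (by simp) ⟨huw, (hboth t ht).2.symm, trivial⟩
    have := f₁ x hx y hy hxy
    simp only [IsSparse] at h1 h2
    tauto
  have hl := h.notMem_left
  have hr := h.notMem_right
  have hn := h.nodup
  have hd := fun x (hx : x ∈ P) => h.disjoint hx
  have hcomp := h.complete
  simp only [List.nodup_cons, List.mem_cons, not_or] at hn hl hr
  refine ⟨Q, insert a (insert b P), f₂, ?_, ?_, by omega, hn.2.2, fun z hz => (hr z (by simp [hz])),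
    ?_, ?_, h.pairing.2, ?_⟩
  · simp only [Finset.mem_insert]
    rintro u hu w (rfl | rfl | hw)
    · exact (hboth u hu).1
    · exact (hboth u hu).2
    · exact (hcomp w hw u hu).symm
  · rw [Finset.card_insert_of_notMem (by grind), Finset.card_insert_of_notMem (by grind)]
    omega
  · grind
  · intro z
    have := h.cover z
    grind
  -- If this triple is not sparse, `a` is adjacent to both `x` and `y`, so by `f₁` `b` is adjacent
  -- to neither.
  · by_cases hs : IsSparse G a x y
    · exact ⟨a, by simp, x, by simp [hx], y, by simp [hy], by grind, hs⟩
    · refine ⟨b, by simp, x, by simp [hx], y, by simp [hy], by grind, ?_⟩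
      have h1 := f₁ x hx y hy hxy
      have h2 := f₁ y hy x hx hxy.symm
      have h3 := hin x hx y hy
      simp only [IsSparse] at hs ⊢
      tauto

theorem IsSplit.exists_nil [Finite V] {G : SimpleGraph V} (hG : NoSparseRest G) :
    ∀ {P Q : Finset V} {R : List V}, IsSplit G P Q R → ∃ P' Q', IsSplit G P' Q' []
  | P, Q, [], h => ⟨P, Q, h⟩
  | _, _, [_], h => h.pairing.elim
  | _, _, _ :: _ :: _, h => by
    obtain ⟨P', Q', h'⟩ := h.step hG
    exact h'.exists_nil hG

/-! ### Edge-stability in terms of three missed vertices -/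

theorem isMaximalMatching_iff {G : SimpleGraph V} {M : G.Subgraph} :
    IsMaximalMatching G M ↔ M.IsMatching ∧ ∀ u ∉ M.verts, ∀ w ∉ M.verts, ¬ G.Adj u w := by
  constructor
  · intro h
    refine ⟨h.1, fun u hu w hw huw => ?_⟩
    have hsup : (M ⊔ G.subgraphOfAdj huw).IsMatching := by
      refine Subgraph.IsMatching.sup h.1 (Subgraph.IsMatching.subgraphOfAdj huw) ?_
      rw [Subgraph.IsMatching.support_eq_verts h.1,
        (Subgraph.IsMatching.subgraphOfAdj huw).support_eq_verts, Set.disjoint_right]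
      simp [hu, hw]
    have := h.2 hsup le_sup_left
    exact hu (this.1 (by simp))
  · rintro ⟨hM, h⟩
    refine ⟨hM, fun N hN hMN => ?_⟩
    have hN : N.IsMatching := hN
    have hv : ∀ v ∈ N.verts, v ∈ M.verts := by
      intro v hv
      by_contra hvM
      obtain ⟨w, hw, -⟩ := hN hv
      refine h v hvM w (fun hwM => hvM ?_) (N.adj_sub hw)
      obtain ⟨v', hv', -⟩ := hM hwM
      rw [hN.eq_of_adj_left hw.symm (hMN.2 hv')]
      exact M.edge_vert hv'.symm
    refine ⟨hv, fun u w huw => ?_⟩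
    obtain ⟨w', hw', -⟩ := hM (hv u (N.edge_vert huw))
    rwa [hN.eq_of_adj_left huw (hMN.2 hw')]

theorem ncard_setOf_mem_of_nodup {l : List V} (h : l.Nodup) : {x | x ∈ l}.ncard = l.length := by
  classical
  rw [← List.toFinset_card_of_nodup h, ← Set.ncard_coe_finset]
  congr 1
  ext
  simp

/-- In an equimatchable graph with a matching missing one vertex only, a smaller matching misses
two adjacent vertices. -/
theorem IsEquimatchable.exists_adj [Finite V] {G : SimpleGraph V} (hG : IsEquimatchable G)
    {l₀ l : List V} {v : V} (hl₀ : IsPairing G l₀) (hn₀ : l₀.Nodup) (hv : ∀ x, x ∈ v :: l₀)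
    (hl : IsPairing G l) (hn : l.Nodup) (hlen : l.length ≠ l₀.length) :
    ∃ u ∉ l, ∃ w ∉ l, G.Adj u w := by
  by_contra! hc
  obtain ⟨M₀, hM₀, hM₀v⟩ := exists_isMatching_of_isPairing hl₀ hn₀
  obtain ⟨M, hM, hMv⟩ := exists_isMatching_of_isPairing hl hn
  have h₀ : IsMaximalMatching G M₀ := by
    refine isMaximalMatching_iff.2 ⟨hM₀, fun u hu w hw huw => huw.ne ?_⟩
    have h1 := hv u
    have h2 := hv w
    simp only [hM₀v, Set.mem_ofPred_eq, List.mem_cons] at hu hw h1 h2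
    rw [h1.resolve_right hu, h2.resolve_right hw]
  have h₁ : IsMaximalMatching G M :=
    isMaximalMatching_iff.2 ⟨hM, fun u hu w hw => hc u (by simpa [hMv] using hu) w
      (by simpa [hMv] using hw)⟩
  have := hG _ _ h₀ h₁
  have e₀ := two_mul_ncard_edgeSet hM₀
  have e₁ := two_mul_ncard_edgeSet hM
  rw [hM₀v, ncard_setOf_mem_of_nodup hn₀] at e₀
  rw [hMv, ncard_setOf_mem_of_nodup hn] at e₁
  omega

theorem IsPairing.deleteEdges {G : SimpleGraph V} {u w : V} : ∀ {l : List V},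
    IsPairing G l → u ∉ l → IsPairing (G.deleteEdges {s(u, w)}) l
  | [], _, _ => trivial
  | [_], hl, _ => hl.elim
  | x :: y :: l, hl, hu => by
    simp only [List.mem_cons, not_or] at hu
    refine ⟨?_, IsPairing.deleteEdges hl.2 hu.2.2⟩
    rw [deleteEdges_adj]
    refine ⟨hl.1, ?_⟩
    simp only [Set.mem_singleton_iff, Sym2.eq_iff]
    rintro (⟨h, -⟩ | ⟨-, h⟩)
    · exact hu.1 h.symm
    · exact hu.2.1 h.symm

/-- Deleting a non-edge changes nothing, so there is no need to ask whether a sparse triple spans an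
edge. -/
theorem IsESE.isEquimatchable_deleteEdges {G : SimpleGraph V} (h : IsESE G) (e : Sym2 V) :
    IsEquimatchable (G.deleteEdges {e}) := by
  by_cases he : e ∈ G.edgeSet
  · exact h.2 e he
  · rw [deleteEdges_eq_self.2 (by simpa using he)]
    exact h.1

/-- After deleting the only possible edge `uw` of a sparse triple, the given matching is maximal
although it is one edge smaller than a near-perfect one. -/
theorem IsESE.noSparseRest [Finite V] {G : SimpleGraph V} (h : IsESE G)
    (hfc : IsFactorCritical G) : NoSparseRest G := by
  intro a b c l hn hall hl hs
  obtain ⟨u, w, hu, hs'⟩ : ∃ u w, u ∉ l ∧ ∀ x ∉ l, ∀ y ∉ l,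
      ¬ (G.deleteEdges {s(u, w)}).Adj x y := by
    have key : ∀ u w, u ∈ [a, b, c] → (∀ x ∈ [a, b, c], ∀ y ∈ [a, b, c],
        ¬ (G.deleteEdges {s(u, w)}).Adj x y) → ∃ u w, u ∉ l ∧ ∀ x ∉ l, ∀ y ∉ l,
      ¬ (G.deleteEdges {s(u, w)}).Adj x y := by
      intro u w hu h'
      have hmem : ∀ x, x ∉ l → x ∈ [a, b, c] := by
        intro x hx
        have := hall x
        simp only [List.mem_cons] at this ⊢
        tauto
      refine ⟨u, w, fun hul => ?_, fun x hx y hy => h' x (hmem x hx) y (hmem y hy)⟩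
      simp only [List.nodup_cons, List.mem_cons] at hn hu
      grind
    rcases hs with hs | hs | hs
    · refine key b c (by simp) ?_
      simp [deleteEdges_adj, hs, G.adj_comm b a, G.adj_comm c a]
    · refine key a c (by simp) ?_
      simp [deleteEdges_adj, hs, G.adj_comm b a, G.adj_comm c b]
    · refine key a b (by simp) ?_
      simp [deleteEdges_adj, hs, G.adj_comm c a, G.adj_comm c b]
  -- A near-perfect matching that misses `u` does not use `uw`, so it survives the deletion.
  obtain ⟨l₀, hl₀, hn₀, hall₀⟩ := isFactorCritical_iff.1 hfc u
  rw [List.nodup_cons] at hn₀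
  have hlen := (perm_of_subset (l := u :: l₀) hn (fun x _ => hall₀ x) (le_antisymm
    ((List.subperm_of_subset (List.nodup_cons.2 hn₀) fun x _ => hall x).length_le)
    ((List.subperm_of_subset hn fun x _ => hall₀ x).length_le))).length_eq
  obtain ⟨x, hx, y, hy, hxy⟩ := (h.isEquimatchable_deleteEdges s(u, w)).exists_adj
    (hl₀.deleteEdges hn₀.1) hn₀.2 hall₀ (hl.deleteEdges hu) (by simp_all) (by
      simp only [List.length_cons] at hlen
      omega)
  exact hs' x hx y hy hxy

/-- Deleting one edge destroys at most one of the two edges among the missed vertices, so a maximal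
matching misses fewer than three vertices, hence by parity exactly one. -/
theorem isESE_of_forall_exists [Finite V] {G : SimpleGraph V} (hodd : Odd (Nat.card V))
    (h : ∀ l, IsPairing G l → l.Nodup → l.length + 3 ≤ Nat.card V →
      ∃ a ∉ l, ∃ b ∉ l, ∃ c ∉ l, ∃ d ∉ l, G.Adj a b ∧ G.Adj c d ∧ s(a, b) ≠ s(c, d)) :
    IsESE G := by
  have key : ∀ H : SimpleGraph V, H ≤ G → (∀ a b c d, G.Adj a b → G.Adj c d →
      s(a, b) ≠ s(c, d) → H.Adj a b ∨ H.Adj c d) → IsEquimatchable H := by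
    intro H hle hH
    have hcard : ∀ M : H.Subgraph, IsMaximalMatching H M →
        2 * M.edgeSet.ncard + 1 = Nat.card V := by
      intro M hM
      rw [isMaximalMatching_iff] at hM
      obtain ⟨l, hl, hn, hm⟩ := exists_isPairing_of_isMatching hM.1
      have h1 := two_mul_ncard_edgeSet hM.1
      have h2 : M.verts.ncard = l.length := by
        rw [← ncard_setOf_mem_of_nodup hn]
        congr 1
        ext x
        simp [hm]
      have h3 := Set.ncard_le_card M.verts
      have h4 : ¬ l.length + 3 ≤ Nat.card V := by
        intro hlen
        obtain ⟨a, ha, b, hb, c, hc, d, hd, hab, hcd, hne⟩ := h l (hl.mono hle) hn hlen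
        rw [hm] at ha hb hc hd
        exact (hH a b c d hab hcd hne).elim (hM.2 a ha b hb) (hM.2 c hc d hd)
      obtain ⟨k, hk⟩ := hodd
      omega
    intro M N hM hN
    have := hcard M hM
    have := hcard N hN
    omega
  refine ⟨key G le_rfl fun a b c d h _ _ => Or.inl h, fun e _ => key _ (deleteEdges_le _) ?_⟩
  intro a b c d hab hcd hne
  by_cases he : s(a, b) = e
  · subst he
    exact Or.inr (deleteEdges_adj.2 ⟨hcd, fun h => hne (by simpa using h.symm)⟩)
  · exact Or.inl (deleteEdges_adj.2 ⟨hab, he⟩)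

/-! ### The first split, from a vertex with two non-neighbours -/

theorem IsPairing.exists_perm_cons {G : SimpleGraph V} {u : V} : ∀ {l : List V},
    IsPairing G l → u ∈ l → ∃ x l', IsPairing G (u :: x :: l') ∧ (u :: x :: l').Perm l
  | [], _, h => by simp at h
  | [_], h, _ => h.elim
  | a :: b :: l, h, hu => by
    rcases List.mem_cons.1 hu with rfl | hu
    · exact ⟨b, l, h, List.Perm.refl _⟩
    rcases List.mem_cons.1 hu with rfl | hu
    · exact ⟨a, l, ⟨h.1.symm, h.2⟩, List.Perm.swap _ _ _⟩
    obtain ⟨x, l', hl', hp⟩ := IsPairing.exists_perm_cons h.2 hu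
    refine ⟨x, a :: b :: l', ⟨hl'.1, h.1, hl'.2⟩, ?_⟩
    refine List.Perm.trans ?_ ((hp.cons b).cons a)
    exact List.perm_append_comm_assoc [u, x] [a, b] l'

/-- Local form of the hypothesis: only the block `F` is rematched, and the matching of `R` is kept.
-/
theorem NoSparseRest.not_isSparse {G : SimpleGraph V} (hG : NoSparseRest G) {F R : List V}
    (hn : (F ++ R).Nodup) (hall : ∀ x, x ∈ F ++ R) (hR : IsPairing G R) (a b c : V) (E : List V)
    (hsub : ∀ z ∈ F, z ∈ a :: b :: c :: E) (hlen : E.length + 3 = F.length)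
    (hE : IsPairing G E) : ¬ IsSparse G a b c := by
  have hp : (a :: b :: c :: (E ++ R)).Perm (F ++ R) :=
    (perm_of_subset (List.nodup_append.1 hn).1 hsub (by simpa using hlen)).append_right R
  exact hG a b c (E ++ R) (hp.nodup_iff.2 hn) (fun x => hp.mem_iff.2 (hall x)) (hE.append hR)

/-- Matching `c₁a` and `c₃c₄` would leave `c₀` with its non-neighbours `c₂` and `b`; hence `c₁a` is
a non-edge, and the triple `c₁`, `a`, `b` must then contain the edge `c₁b`. -/
theorem pentagon_rotate {G : SimpleGraph V} {c₀ c₁ c₂ c₃ c₄ a b : V}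
    (key : ∀ x y z E, (∀ t ∈ [c₀, c₁, c₂, c₃, c₄, a, b], t ∈ x :: y :: z :: E) → E.length = 4 →
      IsPairing G E → ¬ IsSparse G x y z)
    (h23 : G.Adj c₂ c₃) (h34 : G.Adj c₃ c₄) (h40 : G.Adj c₄ c₀) (n02 : ¬ G.Adj c₀ c₂)
    (hb : ¬ G.Adj c₀ b) :
    G.Adj c₁ b ∧ ¬ G.Adj c₁ a := by
  have h1 : ¬ G.Adj c₁ a := fun h =>
    key c₀ c₂ b [c₁, a, c₃, c₄] (by simp) rfl ⟨h, h34, trivial⟩ (Or.inl ⟨n02, hb⟩)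
  have h2 := key c₁ a b [c₂, c₃, c₄, c₀] (by simp) rfl ⟨h23, h40, trivial⟩
  simp only [IsSparse] at h2
  tauto

/-- There is no induced pentagon next to an edge. -/
theorem pentagon_false {G : SimpleGraph V} {c₀ c₁ c₂ c₃ c₄ a b : V}
    (key : ∀ x y z E, (∀ t ∈ [c₀, c₁, c₂, c₃, c₄, a, b], t ∈ x :: y :: z :: E) → E.length = 4 →
      IsPairing G E → ¬ IsSparse G x y z)
    (h01 : G.Adj c₀ c₁) (h12 : G.Adj c₁ c₂) (h23 : G.Adj c₂ c₃) (h34 : G.Adj c₃ c₄)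
    (h40 : G.Adj c₄ c₀) (n02 : ¬ G.Adj c₀ c₂) (n13 : ¬ G.Adj c₁ c₃) (n24 : ¬ G.Adj c₂ c₄)
    (n30 : ¬ G.Adj c₃ c₀) (n41 : ¬ G.Adj c₄ c₁) : False := by
  have r₀ := fun {x y} (k : ∀ t ∈ [c₀, c₁, c₂, c₃, c₄, a, b], t ∈ [c₀, c₁, c₂, c₃, c₄, x, y]) =>
    pentagon_rotate (G := G) (c₀ := c₀) (c₁ := c₁) (c₂ := c₂) (c₃ := c₃) (c₄ := c₄) (a := x)
      (b := y) (fun x' y' z' E hE => key x' y' z' E fun t ht => hE t (k t ht)) h23 h34 h40 n02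
  have r₁ := fun {x y} (k : ∀ t ∈ [c₀, c₁, c₂, c₃, c₄, a, b], t ∈ [c₁, c₂, c₃, c₄, c₀, x, y]) =>
    pentagon_rotate (G := G) (c₀ := c₁) (c₁ := c₂) (c₂ := c₃) (c₃ := c₄) (c₄ := c₀) (a := x)
      (b := y) (fun x' y' z' E hE => key x' y' z' E fun t ht => hE t (k t ht)) h34 h40 h01 n13
  have r₂ := fun {x y} (k : ∀ t ∈ [c₀, c₁, c₂, c₃, c₄, a, b], t ∈ [c₂, c₃, c₄, c₀, c₁, x, y]) =>
    pentagon_rotate (G := G) (c₀ := c₂) (c₁ := c₃) (c₂ := c₄) (c₃ := c₀) (c₄ := c₁) (a := x)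
      (b := y) (fun x' y' z' E hE => key x' y' z' E fun t ht => hE t (k t ht)) h40 h01 h12 n24
  have r₃ := fun {x y} (k : ∀ t ∈ [c₀, c₁, c₂, c₃, c₄, a, b], t ∈ [c₃, c₄, c₀, c₁, c₂, x, y]) =>
    pentagon_rotate (G := G) (c₀ := c₃) (c₁ := c₄) (c₂ := c₀) (c₃ := c₁) (c₄ := c₂) (a := x)
      (b := y) (fun x' y' z' E hE => key x' y' z' E fun t ht => hE t (k t ht)) h01 h12 h23 n30
  have r₄ := fun {x y} (k : ∀ t ∈ [c₀, c₁, c₂, c₃, c₄, a, b], t ∈ [c₄, c₀, c₁, c₂, c₃, x, y]) =>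
    pentagon_rotate (G := G) (c₀ := c₄) (c₁ := c₀) (c₂ := c₁) (c₃ := c₂) (c₄ := c₃) (a := x)
      (b := y) (fun x' y' z' E hE => key x' y' z' E fun t ht => hE t (k t ht)) h12 h23 h34 n41
  have a₀ := r₀ (x := a) (y := b) (by simp)
  have a₁ := r₁ (x := a) (y := b) (by simp)
  have a₂ := r₂ (x := a) (y := b) (by simp)
  have a₃ := r₃ (x := a) (y := b) (by simp)
  have a₄ := r₄ (x := a) (y := b) (by simp)
  have b₀ := r₀ (x := b) (y := a) (by simp)
  have b₁ := r₁ (x := b) (y := a) (by simp)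
  have b₂ := r₂ (x := b) (y := a) (by simp)
  have b₃ := r₃ (x := b) (y := a) (by simp)
  have b₄ := r₄ (x := b) (y := a) (by simp)
  have hc := key c₀ a b [c₁, c₂, c₃, c₄] (by simp) rfl ⟨h12, h34, trivial⟩
  -- A non-adjacency moves around the cycle, alternating between `b` and `a`. Since five is odd, it
  -- returns to `c₀` with the roles of `a` and `b` exchanged.
  have h0 : G.Adj c₀ a → G.Adj c₀ b := by
    intro h
    by_contra h'
    obtain ⟨p, p'⟩ := a₀ h'
    obtain ⟨q, q'⟩ := b₁ p'
    obtain ⟨s, s'⟩ := a₂ q'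
    obtain ⟨t, t'⟩ := b₃ s'
    exact (a₄ t').2 h
  have h0' : G.Adj c₀ b → G.Adj c₀ a := by
    intro h
    by_contra h'
    obtain ⟨p, p'⟩ := b₀ h'
    obtain ⟨q, q'⟩ := a₁ p'
    obtain ⟨s, s'⟩ := b₂ q'
    obtain ⟨t, t'⟩ := a₃ s'
    exact (b₄ t').2 h
  have h0a : G.Adj c₀ a := by
    by_contra h
    exact hc (Or.inl ⟨h, fun h' => h (h0' h')⟩)
  have h2b : G.Adj c₂ b := by
    by_contra h
    obtain ⟨s, s'⟩ := a₂ h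
    obtain ⟨t, t'⟩ := b₃ s'
    exact (a₄ t').2 h0a
  exact key c₁ c₃ c₄ [c₀, a, c₂, b] (by simp) rfl ⟨h0a, h2b, trivial⟩
    (Or.inl ⟨n13, fun h => n41 h.symm⟩)

/-- Exchanges along the matching edges `u x₁` and `w x₂` show that `v` is adjacent to `x₁` and `x₂`,
that `x₁ x₂` is a non-edge, and that `u x₂` and `w x₁` are edges together or not at all. If neither
is an edge, `uw` is, which closes an induced pentagon. -/
theorem exists_isSplit [Finite V] {G : SimpleGraph V} (hG : NoSparseRest G)
    (hfc : IsFactorCritical G) (hcard : 7 ≤ Nat.card V) {u v w : V} (huv : v ≠ u) (hvw : v ≠ w)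
    (huw : u ≠ w) (nu : ¬ G.Adj v u) (nw : ¬ G.Adj v w) : ∃ P Q R, IsSplit G P Q R := by
  classical
  obtain ⟨l, hl, hn, hall⟩ := isFactorCritical_iff.1 hfc v
  have hul : u ∈ l := by have := hall u; simp only [List.mem_cons] at this; tauto
  obtain ⟨x₁, l₁, hl₁, hp₁⟩ := hl.exists_perm_cons hul
  replace hn := (hp₁.cons v).nodup_iff.2 hn
  replace hall : ∀ x, x ∈ v :: u :: x₁ :: l₁ := fun x => (hp₁.cons v).mem_iff.2 (hall x)
  have hvx₁ : G.Adj v x₁ := by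
    have := hG v u x₁ l₁ hn hall hl₁.2
    simp only [IsSparse] at this
    tauto
  have hwx₁ : w ≠ x₁ := by rintro rfl; exact nw hvx₁
  have hwl : w ∈ l₁ := by have := hall w; simp only [List.mem_cons] at this; grind
  obtain ⟨x₂, R, hR, hp₂⟩ := hl₁.2.exists_perm_cons hwl
  have hp := ((hp₂.cons x₁).cons u).cons v
  replace hn : ([v, u, x₁, w, x₂] ++ R).Nodup := hp.nodup_iff.2 hn
  replace hall : ∀ x, x ∈ [v, u, x₁, w, x₂] ++ R := fun x => hp.mem_iff.2 (hall x)
  have hlen : 7 ≤ ([v, u, x₁, w, x₂] ++ R).length := by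
    have h := ncard_setOf_mem_of_nodup hn
    rw [show {x | x ∈ [v, u, x₁, w, x₂] ++ R} = Set.univ from Set.eq_univ_of_forall hall,
      Set.ncard_univ] at h
    omega
  have key := hG.not_isSparse hn hall hR.2
  have hux₁ := hl₁.1
  have hwx₂ := hR.1
  have hvx₂ : G.Adj v x₂ := by
    have := key v w x₂ [u, x₁] (by simp) rfl ⟨hux₁, trivial⟩
    simp only [IsSparse] at this
    tauto
  have n12 : ¬ G.Adj x₁ x₂ := fun h =>
    key v u w [x₁, x₂] (by simp) rfl ⟨h, trivial⟩ (Or.inl ⟨nu, nw⟩)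
  have hu : ¬ G.Adj u x₂ → G.Adj u w := by
    have := key u w x₂ [v, x₁] (by simp) rfl ⟨hvx₁, trivial⟩
    simp only [IsSparse] at this
    tauto
  have hw : ¬ G.Adj w x₁ → G.Adj w u := by
    have := key w u x₁ [v, x₂] (by simp) rfl ⟨hvx₂, trivial⟩
    simp only [IsSparse] at this
    tauto
  have h1 : G.Adj w x₁ → G.Adj u x₂ := by
    intro h
    by_contra h'
    exact key v u x₂ [w, x₁] (by simp) rfl ⟨h, trivial⟩ (Or.inr (Or.inl ⟨nu, h'⟩))
  have h2 : G.Adj u x₂ → G.Adj w x₁ := by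
    intro h
    by_contra h'
    exact key v w x₁ [u, x₂] (by simp) rfl ⟨h, trivial⟩ (Or.inr (Or.inl ⟨nw, h'⟩))
  have hux₂ : G.Adj u x₂ := by
    by_contra hc
    -- Seven vertices guarantee a further matching edge `ab` beside the pentagon.
    obtain _ | ⟨a, _ | ⟨b, R⟩⟩ := R
    · simp at hlen
    · exact hR.2.elim
    · have hp : ([v, u, x₁, w, x₂] ++ (a :: b :: R)) = [v, u, x₁, w, x₂, a, b] ++ R := rfl
      rw [hp] at hn hall
      have key' := hG.not_isSparse hn hall hR.2.2
      have hsub : ∀ t ∈ [v, u, x₁, w, x₂, a, b], t ∈ [v, x₁, u, w, x₂, a, b] := by simp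
      exact pentagon_false (c₀ := v) (c₁ := x₁) (c₂ := u) (c₃ := w) (c₄ := x₂) (a := a) (b := b)
        (fun x y z E hE hEl => key' x y z E (fun t ht => hE t (hsub t ht)) (by simp [hEl]))
        hvx₁ hux₁.symm (hu hc) hwx₂ hvx₂.symm nu (fun h => hc (h1 h.symm)) hc (fun h => nw h.symm)
        (fun h => n12 h.symm)
  have hwx₁' := h2 hux₂
  simp only [List.nodup_append, List.nodup_cons, List.mem_cons, not_or, List.mem_append] at hn hall
  refine ⟨{x₁, x₂}, {v, u, w}, R, ?_, ?_, ?_, ?_, hn.2.1, ?_, ?_, ?_, hR.2, v, by simp, u,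
    by simp, w, by simp, by simp [*], Or.inl ⟨nu, nw⟩⟩
  · simp [n12, G.adj_comm x₂ x₁]
  · simp [hux₁.symm, hvx₁.symm, hvx₂.symm, hwx₂.symm, hux₂.symm, hwx₁'.symm]
  · rw [Finset.card_pair (by grind), Finset.card_eq_three.2 ⟨v, u, w, huv, hvw, huw, rfl⟩]
  · rw [Finset.card_pair (by grind)]
  · grind
  · grind
  · grind

/-! ### Counting covered vertices; complete splits lie in 𝒢₂ -/

theorem IsPairing.two_mul_countP_le {G : SimpleGraph V} (p : V → Prop) [DecidablePred p] :
    ∀ {l : List V}, IsPairing G l → (∀ u ∈ l, ∀ w ∈ l, p u → p w → ¬ G.Adj u w) →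
      2 * l.countP (fun x => decide (p x)) ≤ l.length
  | [], _, _ => by simp
  | [_], hl, _ => hl.elim
  | u :: w :: l, hl, h => by
    have ih := IsPairing.two_mul_countP_le p hl.2
      fun x hx y hy => h x (by simp [hx]) y (by simp [hy])
    have := h u (by simp) w (by simp)
    have hadj := hl.1
    simp only [List.countP_cons, List.length_cons, decide_eq_true_eq]
    by_cases hu : p u <;> by_cases hw : p w <;> simp only [hu, hw, if_true, if_false] <;>
      first | omega | tauto

/-- Each matching edge meets the class at most once, except for at most one edge lying inside it. -/
theorem IsPairing.two_mul_countP_le_add_two {G : SimpleGraph V} (p : V → Prop)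
    [DecidablePred p] (h : ∀ a b c d, p a → p b → p c → p d → G.Adj a b → G.Adj c d →
      ¬ [a, b, c, d].Nodup) :
    ∀ {l : List V}, IsPairing G l → l.Nodup →
      2 * l.countP (fun x => decide (p x)) ≤ l.length + 2
  | [], _, _ => by simp
  | [_], hl, _ => hl.elim
  | u :: w :: l, hl, hn => by
    have ih := IsPairing.two_mul_countP_le_add_two p h hl.2 (by simp_all)
    simp only [List.countP_cons, List.length_cons, decide_eq_true_eq]
    by_cases huw : p u ∧ p w
    · have := hl.2.two_mul_countP_le p fun x hx y hy hpx hpy hxy =>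
        h u w x y huw.1 huw.2 hpx hpy hl.1 hxy (by
          have := hxy.ne
          simp only [List.nodup_cons, List.mem_cons] at hn ⊢
          grind)
      simp only [huw, if_true]
      omega
    · by_cases hu : p u <;> by_cases hw : p w <;> simp only [hu, hw, if_true, if_false] <;>
        first | omega | tauto

theorem countP_mem_eq_card [DecidableEq V] {l : List V} (hn : l.Nodup) (S : Finset V) :
    l.countP (fun x => decide (x ∈ S)) = (S.filter (· ∈ l)).card := by
  rw [List.countP_eq_length_filter, ← List.toFinset_card_of_nodup (hn.filter _)]
  congr 1
  ext x
  simp [and_comm]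

theorem countP_mem_add_card [DecidableEq V] {l : List V} (hn : l.Nodup) (S : Finset V) :
    l.countP (fun x => decide (x ∈ S)) + (S.filter (· ∉ l)).card = S.card := by
  rw [countP_mem_eq_card hn, Finset.card_filter_add_card_filter_not]

theorem matchingNumber_induce_compl_eq_one_iff [Finite V] {G : SimpleGraph V} {S : Set V} :
    matchingNumber (G.induce Sᶜ) = 1 ↔ (∃ u ∉ S, ∃ w ∉ S, G.Adj u w) ∧
      ∀ a ∉ S, ∀ b ∉ S, ∀ c ∉ S, ∀ d ∉ S, G.Adj a b → G.Adj c d → ¬ [a, b, c, d].Nodup := by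
  rw [matchingNumber_eq_one_iff]
  refine and_congr ⟨?_, ?_⟩ ⟨?_, ?_⟩
  · rintro ⟨u, w, h⟩
    exact ⟨u, u.2, w, w.2, h⟩
  · rintro ⟨u, hu, w, hw, h⟩
    exact ⟨⟨u, hu⟩, ⟨w, hw⟩, h⟩
  · intro h a ha b hb c hc d hd hab hcd hn
    refine h ⟨a, ha⟩ ⟨b, hb⟩ ⟨c, hc⟩ ⟨d, hd⟩ hab hcd ?_
    simpa [Subtype.ext_iff] using hn
  · intro h a b c d hab hcd hn
    refine h a a.2 b b.2 c c.2 d d.2 hab hcd ?_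
    simpa [Subtype.ext_iff] using hn

/-- Every vertex is adjacent to all others, with at most one exception. -/
def IsAlmostComplete (G : SimpleGraph V) : Prop :=
  ∀ v u w, v ≠ u → v ≠ w → u ≠ w → G.Adj v u ∨ G.Adj v w

/-- If `Q` were independent, a perfect matching after removing a vertex of `P` could not cover it,
as `|Q| > |P|`. Two disjoint edges in `Q` would extend to a matching missing exactly three vertices
of the independent set `P`. -/
theorem IsSplit.isFamilyTwoSet [Fintype V] {G : SimpleGraph V} (hG : NoSparseRest G)
    (hfc : IsFactorCritical G) (hcard : 7 ≤ Fintype.card V) {P Q : Finset V}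
    (h : IsSplit G P Q []) : IsFamilyTwoSet G P := by
  classical
  have hQ : ∀ x, x ∉ P ↔ x ∈ Q := by
    intro x
    have h1 := h.cover x
    have h2 := h.disjoint (x := x)
    simp only [List.not_mem_nil, or_false] at h1
    tauto
  have hQc : Q = Pᶜ := by ext x; simp [hQ]
  have hc := h.card_eq
  have hsum := Finset.card_add_card_compl P
  rw [← hQc] at hsum
  refine ⟨fun x hx y hy _ => h.indep x hx y hy, by rw [Set.ncard_coe_finset]; omega,
    fun x hx y hy => h.complete x hx y ((hQ y).1 hy), ?_⟩
  rw [matchingNumber_induce_compl_eq_one_iff]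
  simp only [Finset.mem_coe, hQ]
  constructor
  · by_contra! hc'
    obtain ⟨x, hx⟩ : P.Nonempty := Finset.card_pos.1 (by omega)
    obtain ⟨l, hl, hn, hall⟩ := isFactorCritical_iff.1 hfc x
    have h1 := hl.two_mul_countP_le (· ∈ Q) fun u _ w _ hu hw => hc' u hu w hw
    have hn' := (List.nodup_cons.1 hn).2
    have h2 := countP_mem_add_card hn' Q
    have h3 : Q.filter (· ∉ l) = ∅ := by
      rw [Finset.filter_eq_empty_iff]
      intro y hy
      have := hall y
      have := h.disjoint hx
      simp only [List.mem_cons] at *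
      grind
    have h4 : (x :: l).length = Fintype.card V := by
      have := ncard_setOf_mem_of_nodup hn
      rw [← this, show {y | y ∈ x :: l} = Set.univ from Set.eq_univ_of_forall hall,
        Set.ncard_univ, Nat.card_eq_fintype_card]
    simp only [h3, Finset.card_empty, List.length_cons] at h2 h4
    omega
  · intro a ha b hb c hc d hd hab hcd hn
    have hsubQ : [a, b, c, d].toFinset ⊆ Q := by simp [Finset.insert_subset_iff, ha, hb, hc, hd]
    have hcardQ := List.toFinset_card_of_nodup hn
    obtain ⟨x, y, z, hx, hy, hz, hxy, hxz, hyz⟩ :=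
      Finset.two_lt_card_iff.1 (show 2 < P.card by omega)
    have hsubP : {x, y, z} ⊆ P := by simp [Finset.insert_subset_iff, hx, hy, hz]
    have hcardP : ({x, y, z} : Finset V).card = 3 :=
      Finset.card_eq_three.2 ⟨x, y, z, hxy, hxz, hyz, rfl⟩
    obtain ⟨Z, hZ, hZn, hZm⟩ := exists_isPairing_of_card_eq (G := G) (P := P \ {x, y, z})
      (Q := Q \ [a, b, c, d].toFinset)
      (fun x hx q hq => h.complete x (Finset.mem_sdiff.1 hx).1 q (Finset.mem_sdiff.1 hq).1) (by
        rw [Finset.card_sdiff_of_subset hsubP, Finset.card_sdiff_of_subset hsubQ, hcardP, hcardQ]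
        simp only [List.length_cons, List.length_nil]
        omega)
    have hd' := fun x (hx : x ∈ P) => h.disjoint hx
    refine hG x y z ([a, b, c, d] ++ Z) ?_ ?_ ?_ (Or.inl ⟨h.indep x hx y hy, h.indep x hx z hz⟩)
    · rw [show x :: y :: z :: ([a, b, c, d] ++ Z) = [x, y, z] ++ ([a, b, c, d] ++ Z) from rfl,
        List.nodup_append, List.nodup_append]
      refine ⟨by simp [*], ⟨hn, hZn, ?_⟩, ?_⟩
      · intro s hs t ht hst
        simp only [hZm, Finset.mem_sdiff, List.mem_toFinset] at ht
        have : s ∈ Q := hsubQ (by simpa using hs)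
        grind
      · intro s hs t ht hst
        have hsP : s ∈ P := hsubP (by simpa using hs)
        have hsQ := hd' s hsP
        rw [List.mem_append, hZm] at ht
        subst hst
        rcases ht with ht | ht | ht
        · exact hsQ (hsubQ (by simpa using ht))
        · exact (Finset.mem_sdiff.1 ht).2 (by simpa using hs)
        · exact hsQ (Finset.mem_sdiff.1 ht).1
    · intro t
      have := hQ t
      simp only [List.mem_cons, List.mem_append, hZm, Finset.mem_sdiff, List.mem_toFinset,
        Finset.mem_insert, Finset.mem_singleton]
      tauto
    · exact IsPairing.append (l := [a, b, c, d]) ⟨hab, hcd, trivial⟩ hZ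

/-- The dichotomy behind the classification of factor-critical ESE-graphs. -/
theorem isAlmostComplete_or_isFamilyTwo [Fintype V] {G : SimpleGraph V}
    (hfc : IsFactorCritical G) (hG : IsESE G) (hcard : 7 ≤ Fintype.card V) :
    IsAlmostComplete G ∨ IsFamilyTwo G := by
  by_cases h : IsAlmostComplete G
  · exact Or.inl h
  · right
    simp only [IsAlmostComplete, not_forall, not_or] at h
    obtain ⟨v, u, w, hvu, hvw, huw, nu, nw⟩ := h
    have hs := hG.noSparseRest hfc
    obtain ⟨P, Q, R, h⟩ := exists_isSplit hs hfc (by rwa [Nat.card_eq_fintype_card]) hvu hvw huw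
      nu nw
    obtain ⟨P', Q', h'⟩ := h.exists_nil hs
    exact ⟨_, h'.isFamilyTwoSet hs hfc hcard⟩

/-! ### Members of 𝒢₂ on 2r+1 vertices -/

theorem length_of_forall_mem [Fintype V] {l : List V} (hn : l.Nodup) (h : ∀ x, x ∈ l) :
    l.length = Fintype.card V := by
  rw [← ncard_setOf_mem_of_nodup hn, show {y | y ∈ l} = Set.univ from Set.eq_univ_of_forall h,
    Set.ncard_univ, Nat.card_eq_fintype_card]

/-- Removing a vertex outside `S`, the matching covers the independent set `S`, so `|S| ≤ r`.
Removing a vertex of `S`, it covers the complement, which has matching number one, so `|Sᶜ| ≤ r +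
1`. The two sizes add up to `2r + 1`. -/
theorem IsFamilyTwoSet.card_eq [Fintype V] {G : SimpleGraph V} (hfc : IsFactorCritical G) {r : ℕ}
    (hcard : Fintype.card V = 2 * r + 1) {S : Finset V} (h : IsFamilyTwoSet G S) :
    S.card = r := by
  classical
  have hm := matchingNumber_induce_compl_eq_one_iff.1 h.matching
  simp only [Finset.mem_coe] at hm
  have hS := h.card
  rw [Set.ncard_coe_finset] at hS
  have hsum := Finset.card_add_card_compl S
  obtain ⟨v, hv, -⟩ := hm.1
  obtain ⟨x, hx⟩ : S.Nonempty := Finset.card_pos.1 (by omega)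
  have key : ∀ (v : V) (T : Finset V), v ∉ T → ∃ l, IsPairing G l ∧ l.Nodup ∧
      l.length = 2 * r ∧ l.countP (fun x => decide (x ∈ T)) = T.card := by
    intro v T hv
    obtain ⟨l, hl, hn, hall⟩ := isFactorCritical_iff.1 hfc v
    have hlen := length_of_forall_mem hn hall
    rw [List.nodup_cons] at hn
    refine ⟨l, hl, hn.2, by simp at hlen; omega, ?_⟩
    rw [countP_mem_eq_card hn.2, Finset.filter_true_of_mem]
    intro y hy
    have := hall y
    simp only [List.mem_cons] at this
    grind
  obtain ⟨l₁, hl₁, hn₁, hlen₁, hc₁⟩ := key v S hv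
  obtain ⟨l₂, hl₂, hn₂, hlen₂, hc₂⟩ := key x Sᶜ (by simpa using hx)
  have h1 := hl₁.two_mul_countP_le (· ∈ S) fun u _ w _ hu hw huw => h.indep hu hw huw.ne huw
  have h2 := hl₂.two_mul_countP_le_add_two (· ∈ Sᶜ) (fun a b c d ha hb hc hd =>
    hm.2 a (by simpa using ha) b (by simpa using hb) c (by simpa using hc) d (by simpa using hd)) hn₂
  omega

/-- A matching missing at least three vertices misses some on each side of `S`, and two on one side;
this leaves two crossing edges. -/
theorem IsFamilyTwoSet.isESE [Fintype V] {G : SimpleGraph V} {S : Finset V}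
    (h : IsFamilyTwoSet G S) (hcard : Fintype.card V = 2 * S.card + 1) : IsESE G := by
  classical
  have hm := matchingNumber_induce_compl_eq_one_iff.1 h.matching
  simp only [Finset.mem_coe] at hm
  have hsum := Finset.card_add_card_compl S
  rw [← Nat.card_eq_fintype_card] at hcard
  refine isESE_of_forall_exists ⟨_, hcard⟩ fun l hl hn hlen => ?_
  have h1 := hl.two_mul_countP_le (· ∈ S) fun u _ w _ hu hw huw => h.indep hu hw huw.ne huw
  have h2 := hl.two_mul_countP_le_add_two (· ∈ Sᶜ) (fun a b c d ha hb hc hd =>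
    hm.2 a (by simpa using ha) b (by simpa using hb) c (by simpa using hc) d (by simpa using hd)) hn
  have h3 := countP_mem_add_card hn S
  have h4 := countP_mem_add_card hn Sᶜ
  have h5 : l.countP (fun x => decide (x ∈ S)) + l.countP (fun x => decide (x ∈ Sᶜ))
      = l.length := by
    rw [List.length_eq_countP_add_countP (fun x => decide (x ∈ S))]
    congr 2
    ext x
    simp
  rw [Nat.card_eq_fintype_card] at hcard hlen
  obtain ⟨k, hk⟩ := hl.even_length
  obtain ⟨x, hx⟩ : (S.filter (· ∉ l)).Nonempty := Finset.card_pos.1 (by omega)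
  obtain ⟨y, hy⟩ : (Sᶜ.filter (· ∉ l)).Nonempty := Finset.card_pos.1 (by omega)
  simp only [Finset.mem_filter, Finset.mem_compl] at hx hy
  have hadj := h.complete x hx.1 y hy.1
  rcases (show 1 < (S.filter (· ∉ l)).card ∨ 1 < (Sᶜ.filter (· ∉ l)).card by omega) with hc | hc
  · obtain ⟨x', hx', hne⟩ := Finset.exists_mem_ne hc x
    simp only [Finset.mem_filter] at hx'
    refine ⟨x, hx.2, y, hy.2, x', hx'.2, y, hy.2, hadj, h.complete x' hx'.1 y hy.1, ?_⟩
    simp only [ne_eq, Sym2.eq_iff, hne.symm, false_and, false_or, not_and]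
    exact fun e => (hadj.ne e).elim
  · obtain ⟨y', hy', hne⟩ := Finset.exists_mem_ne hc y
    simp only [Finset.mem_filter, Finset.mem_compl] at hy'
    refine ⟨x, hx.2, y, hy.2, x, hx.2, y', hy'.2, hadj, h.complete x hx.1 y' hy'.1, ?_⟩
    simp only [ne_eq, Sym2.eq_iff, hne.symm, true_and, false_or, not_and]
    exact fun _ e => hadj.ne e.symm

/-- If the removed vertex lies in `S`, one edge of the complement restores the balance of the two
sides. -/
theorem IsFamilyTwoSet.isFactorCritical [Fintype V] {G : SimpleGraph V} {S : Finset V}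
    (h : IsFamilyTwoSet G S) (hcard : Fintype.card V = 2 * S.card + 1) :
    IsFactorCritical G := by
  classical
  have hm := matchingNumber_induce_compl_eq_one_iff.1 h.matching
  simp only [Finset.mem_coe] at hm
  have hsum := Finset.card_add_card_compl S
  have hcomp : ∀ A ⊆ S, ∀ B ⊆ Sᶜ, ∀ x ∈ A, ∀ q ∈ B, G.Adj x q := fun A hA B hB x hx q hq =>
    h.complete x (hA hx) q (by simpa using hB hq)
  rw [isFactorCritical_iff]
  intro v
  by_cases hv : v ∈ S
  · obtain ⟨⟨u, hu, w, hw, huw⟩, -⟩ := hm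
    have hsub : ({u, w} : Finset V) ⊆ Sᶜ := by simp [Finset.insert_subset_iff, *]
    obtain ⟨l, hl, hn, hall⟩ := exists_isPairing_of_card_eq (G := G) (P := S.erase v)
      (Q := Sᶜ \ {u, w}) (hcomp _ (Finset.erase_subset _ _) _ Finset.sdiff_subset) (by
        rw [Finset.card_erase_of_mem hv, Finset.card_sdiff_of_subset hsub,
          Finset.card_pair huw.ne]
        omega)
    have := huw.ne
    refine ⟨u :: w :: l, ⟨huw, hl⟩, ?_, ?_⟩
    · simp only [List.nodup_cons, List.mem_cons, hall, Finset.mem_erase, Finset.mem_sdiff,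
        Finset.mem_insert, Finset.mem_singleton, Finset.mem_compl]
      grind
    · intro x
      simp only [List.mem_cons, hall, Finset.mem_erase, Finset.mem_sdiff,
        Finset.mem_insert, Finset.mem_singleton, Finset.mem_compl]
      tauto
  · obtain ⟨l, hl, hn, hall⟩ := exists_isPairing_of_card_eq (G := G) (P := S)
      (Q := Sᶜ.erase v) (hcomp _ subset_rfl _ (Finset.erase_subset _ _)) (by
        rw [Finset.card_erase_of_mem (by simpa using hv)]
        omega)
    refine ⟨l, hl, ?_, ?_⟩
    · simp only [List.nodup_cons, hall, Finset.mem_erase, Finset.mem_compl]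
      grind
    · intro x
      simp only [List.mem_cons, hall, Finset.mem_erase, Finset.mem_compl]
      tauto

/-! ### Almost complete graphs -/

/-- The induction starts at four vertices because two vertices may be non-adjacent. -/
theorem IsAlmostComplete.exists_isPairing {G : SimpleGraph V} (h : IsAlmostComplete G) :
    ∀ (m : ℕ) (A : Finset V), A.card = 2 * m + 4 →
      ∃ l, IsPairing G l ∧ l.Nodup ∧ ∀ x, x ∈ l ↔ x ∈ A := by
  classical
  intro m
  induction m with
  | zero =>
    intro A hA
    obtain ⟨a, b, c, d, hab, hac, had, hbc, hbd, hcd, rfl⟩ := Finset.card_eq_four.1 hA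
    have : (G.Adj a b ∧ G.Adj c d) ∨ (G.Adj a c ∧ G.Adj b d) := by
      by_cases h1 : G.Adj a b
      · by_cases h2 : G.Adj c d
        · exact Or.inl ⟨h1, h2⟩
        · exact Or.inr ⟨((h c d a hcd hac.symm had.symm).resolve_left h2).symm,
            ((h d c b hcd.symm hbd.symm hbc.symm).resolve_left fun e => h2 e.symm).symm⟩
      · exact Or.inr ⟨(h a b c hab hac hbc).resolve_left h1,
          (h b a d hab.symm hbd had).resolve_left fun e => h1 e.symm⟩
    rcases this with ⟨e, f⟩ | ⟨e, f⟩
    · exact ⟨[a, b, c, d], ⟨e, f, trivial⟩, by simp [hab, hac, had, hbc, hbd, hcd], by simp⟩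
    · exact ⟨[a, c, b, d], ⟨e, f, trivial⟩, by simp [hab, hac, had, hbc.symm, hbd, hcd],
        by intro x; simp [or_left_comm]⟩
  | succ m ih =>
    intro A hA
    obtain ⟨u, w, hu, hw, huw⟩ : ∃ u w, u ∈ A ∧ w ∈ A ∧ G.Adj u w := by
      obtain ⟨x, y, z, hx, hy, hz, hxy, hxz, hyz⟩ :=
        Finset.two_lt_card_iff.1 (show 2 < A.card by omega)
      exact (h x y z hxy hxz hyz).elim (fun e => ⟨x, y, hx, hy, e⟩) fun e => ⟨x, z, hx, hz, e⟩
    have hsub : ({u, w} : Finset V) ⊆ A := by simp [Finset.insert_subset_iff, *]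
    obtain ⟨l, hl, hn, hall⟩ := ih (A \ {u, w}) (by
      rw [Finset.card_sdiff_of_subset hsub, Finset.card_pair huw.ne]; omega)
    refine ⟨u :: w :: l, ⟨huw, hl⟩, by simp [hall, hn, huw.ne], fun x => ?_⟩
    simp only [List.mem_cons, hall, Finset.mem_sdiff, Finset.mem_insert, Finset.mem_singleton]
    grind

theorem IsAlmostComplete.isFactorCritical [Fintype V] {G : SimpleGraph V}
    (h : IsAlmostComplete G) {r : ℕ} (hr : 2 ≤ r) (hcard : Fintype.card V = 2 * r + 1) :
    IsFactorCritical G := by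
  classical
  rw [isFactorCritical_iff]
  intro v
  obtain ⟨l, hl, hn, hall⟩ := h.exists_isPairing (r - 2) ({v}ᶜ) (by
    rw [Finset.card_compl, Finset.card_singleton]; omega)
  exact ⟨l, hl, by simp [hn, hall], fun x => by simp [hall, em]⟩

theorem IsAlmostComplete.isESE [Fintype V] {G : SimpleGraph V}
    (h : IsAlmostComplete G) (hodd : Odd (Fintype.card V)) : IsESE G := by
  classical
  rw [← Nat.card_eq_fintype_card] at hodd
  refine isESE_of_forall_exists hodd fun l hl hn hlen => ?_
  obtain ⟨x, y, z, hx, hy, hz, hxy, hxz, hyz⟩ :=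
    Finset.two_lt_card_iff.1 (show 2 < (l.toFinsetᶜ).card by
      rw [Finset.card_compl, List.toFinset_card_of_nodup hn, ← Nat.card_eq_fintype_card]; omega)
  simp only [Finset.mem_compl, List.mem_toFinset] at hx hy hz
  have h1 := h x y z hxy hxz hyz
  have h2 := h y x z hxy.symm hyz hxz
  have h3 := h z x y hxz.symm hyz.symm hxy
  have e1 : s(x, y) ≠ s(x, z) := by rw [ne_eq, Sym2.eq_iff]; grind
  have e2 : s(x, y) ≠ s(y, z) := by rw [ne_eq, Sym2.eq_iff]; grind
  have e3 : s(x, z) ≠ s(y, z) := by rw [ne_eq, Sym2.eq_iff]; grind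
  by_cases axy : G.Adj x y <;> by_cases axz : G.Adj x z
  · exact ⟨x, hx, y, hy, x, hx, z, hz, axy, axz, e1⟩
  · exact ⟨x, hx, y, hy, y, hy, z, hz, axy, (h3.resolve_left fun e => axz e.symm).symm, e2⟩
  · exact ⟨x, hx, z, hz, y, hy, z, hz, axz, h2.resolve_left fun e => axy e.symm, e3⟩
  · exact absurd h1 (by tauto)

/-- A graph with matching number one is a star or a triangle, up to isolated vertices. -/
theorem isStarPlusIsolated_or_isTrianglePlusIsolated [Fintype V] {H : SimpleGraph V}
    (h : matchingNumber H = 1) :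
    (∃ k, 1 ≤ k ∧ k < Fintype.card V ∧ IsStarPlusIsolated k H) ∨ IsTrianglePlusIsolated H := by
  classical
  obtain ⟨⟨u, w, huw⟩, hd⟩ := matchingNumber_eq_one_iff.1 h
  have hd' : ∀ a b c d, H.Adj a b → H.Adj c d → a = c ∨ a = d ∨ b = c ∨ b = d := by
    intro a b c d hab hcd
    have := hd a b c d hab hcd
    have := hab.ne
    have := hcd.ne
    simp only [List.nodup_cons, List.mem_cons] at *
    grind
  have star : ∀ c z, H.Adj c z → (∀ x y, H.Adj x y → x = c ∨ y = c) →
      ∃ k, 1 ≤ k ∧ k < Fintype.card V ∧ IsStarPlusIsolated k H := by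
    intro c z hcz hc
    refine ⟨(H.neighborFinset c).card, Finset.card_pos.2 ⟨z, by simpa⟩,
      H.degree_lt_card_verts c, c, H.neighborFinset c, by simp, rfl, fun x y => ?_⟩
    simp only [mem_neighborFinset]
    constructor
    · intro hxy
      rcases hc x y hxy with rfl | rfl
      · exact Or.inl ⟨rfl, hxy⟩
      · exact Or.inr ⟨rfl, hxy.symm⟩
    · rintro (⟨rfl, hxy⟩ | ⟨rfl, hxy⟩)
      · exact hxy
      · exact hxy.symm
  -- Edges meet pairwise. If neither end of `uw` is a centre, an edge avoiding `u` has the form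
  -- `wz`, and an edge avoiding `w` has to be `uz`.
  by_cases hu : ∀ x y, H.Adj x y → x = u ∨ y = u
  · exact Or.inl (star u w huw hu)
  by_cases hw : ∀ x y, H.Adj x y → x = w ∨ y = w
  · exact Or.inl (star w u huw.symm hw)
  right
  push Not at hu hw
  obtain ⟨z, hwz, hzu⟩ : ∃ z, H.Adj w z ∧ z ≠ u := by
    obtain ⟨x, y, hxy, hxu, hyu⟩ := hu
    rcases hd' u w x y huw hxy with e | e | e | e
    · exact absurd e.symm hxu
    · exact absurd e.symm hyu
    · exact ⟨y, e ▸ hxy, hyu⟩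
    · exact ⟨x, e ▸ hxy.symm, hxu⟩
  have huz : H.Adj u z := by
    obtain ⟨x, y, hxy, hxw, hyw⟩ := hw
    have h1 := hd' u w x y huw hxy
    have h2 := hd' w z x y hwz hxy
    have := huw.ne
    have : (x = u ∧ y = z) ∨ (y = u ∧ x = z) := by grind
    rcases this with ⟨rfl, rfl⟩ | ⟨rfl, rfl⟩
    · exact hxy
    · exact hxy.symm
  refine ⟨{u, w, z}, Finset.card_eq_three.2 ⟨u, w, z, huw.ne, hzu.symm, hwz.ne, rfl⟩,
    fun x y => ?_⟩
  simp only [Finset.mem_insert, Finset.mem_singleton]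
  constructor
  · intro hxy
    have h1 := hd' u w x y huw hxy
    have h2 := hd' w z x y hwz hxy
    have h3 := hd' u z x y huz hxy
    have h4 := hxy.ne
    have h5 := huw.ne
    have h6 := hwz.ne
    grind
  · rintro ⟨hne, rfl | rfl | rfl, rfl | rfl | rfl⟩ <;>
      first | exact absurd rfl hne | assumption | (apply H.symm.symm; assumption)

/-! ### Isomorphism by colour classes; complete graphs minus a matching -/

/-- Adjacency depends only on the colours of the ends, so any bijection preserving colours is an
isomorphism. -/
theorem nonempty_iso_of_coloring {W C : Type*} [Fintype V] [Fintype W] [DecidableEq C]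
    {G : SimpleGraph V} {H : SimpleGraph W} (κ : V → C) (κ' : W → C) (R : C → C → Prop)
    (hcard : ∀ c, (Finset.univ.filter fun v => κ v = c).card =
      (Finset.univ.filter fun w => κ' w = c).card)
    (hG : ∀ u w, G.Adj u w ↔ u ≠ w ∧ R (κ u) (κ w))
    (hH : ∀ u w, H.Adj u w ↔ u ≠ w ∧ R (κ' u) (κ' w)) : Nonempty (G ≃g H) := by
  have e : ∀ c, Nonempty ({v // κ v = c} ≃ {w // κ' w = c}) := fun c => by
    rw [← Fintype.card_eq, Fintype.card_subtype, Fintype.card_subtype, hcard]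
  refine ⟨⟨Equiv.ofFiberEquiv fun c => (e c).some, fun {u w} => ?_⟩⟩
  rw [hG, hH, Equiv.ofFiberEquiv_map (g := κ'), Equiv.ofFiberEquiv_map (g := κ'),
    (Equiv.injective _).ne_iff]

theorem IsAlmostComplete.of_iso {W : Type*} {G : SimpleGraph V} {H : SimpleGraph W}
    (h : IsAlmostComplete H) (f : G ≃g H) : IsAlmostComplete G := by
  intro v u w hvu hvw huw
  rw [← f.map_adj_iff, ← f.map_adj_iff]
  exact h _ _ _ (f.injective.ne hvu) (f.injective.ne hvw) (f.injective.ne huw)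

theorem IsCompleteMinusMatching.isAlmostComplete {n k : ℕ} {G : SimpleGraph V}
    (h : IsCompleteMinusMatching n k G) : IsAlmostComplete G := by
  obtain ⟨M, hM, -, ⟨f⟩⟩ := h
  refine IsAlmostComplete.of_iso (fun v u w hvu hvw huw => ?_) f
  simp only [deleteEdges_adj, top_adj, Subgraph.mem_edgeSet]
  by_contra hc
  have h1 : M.Adj v u := by tauto
  have h2 : M.Adj v w := by tauto
  exact huw (hM.eq_of_adj_left h1 h2)

/-- The non-edges form the matching, and `2k ≤ 2r + 1` bounds its size. -/
theorem IsAlmostComplete.exists_isCompleteMinusMatching {r : ℕ}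
    {G : SimpleGraph (Fin (2 * r + 1))} (h : IsAlmostComplete G) :
    ∃ k ≤ r, IsCompleteMinusMatching (2 * r + 1) k G := by
  let M : (⊤ : SimpleGraph (Fin (2 * r + 1))).Subgraph :=
    { verts := {v | ∃ u, v ≠ u ∧ ¬ G.Adj v u}
      Adj := fun u w => u ≠ w ∧ ¬ G.Adj u w
      adj_sub := fun h => h.1
      edge_vert := fun h => ⟨_, h⟩
      symm := ⟨fun _ _ h => ⟨h.1.symm, fun e => h.2 e.symm⟩⟩ }
  have hM : M.IsMatching := by
    rintro v ⟨u, hvu⟩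
    refine ⟨u, hvu, fun w hvw => ?_⟩
    by_contra hne
    exact (h v w u hvw.1 hvu.1 hne).elim hvw.2 hvu.2
  have h1 := two_mul_ncard_edgeSet hM
  have h2 := Set.ncard_le_card M.verts
  rw [Nat.card_eq_fintype_card, Fintype.card_fin] at h2
  refine ⟨M.edgeSet.ncard, by omega, M, hM, rfl, ⟨?_⟩⟩
  have : G = (⊤ : SimpleGraph (Fin (2 * r + 1))).deleteEdges M.edgeSet := by
    ext u w
    simp only [deleteEdges_adj, top_adj, Subgraph.mem_edgeSet, M]
    have := fun h : G.Adj u w => h.ne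
    tauto
  rw [← this]

/-- The colour of a vertex is the matching edge that covers it, or `none`. -/
theorem IsCompleteMinusMatching.exists_coloring {n k : ℕ} {G : SimpleGraph V} [Fintype V]
    (h : IsCompleteMinusMatching n k G) : ∃ κ : V → Option (Fin k),
      (∀ i, (Finset.univ.filter fun v => κ v = some i).card = 2) ∧
      ∀ u w, G.Adj u w ↔ u ≠ w ∧ ¬ (κ u = κ w ∧ κ u ≠ none) := by
  classical
  obtain ⟨M, hM, hk, ⟨f⟩⟩ := h
  obtain ⟨e⟩ : Nonempty (M.edgeSet ≃ Fin k) := by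
    rw [← Fintype.card_eq, Fintype.card_fin, ← hk, ← Nat.card_eq_fintype_card,
      Nat.card_coe_set_eq]
  let κ : Fin n → Option (Fin k) := fun v =>
    if hv : v ∈ M.verts then some (e (hM.toEdge ⟨v, hv⟩)) else none
  have hκ : ∀ {u w} (huw : M.Adj u w), κ u = some (e ⟨s(u, w), Subgraph.mem_edgeSet.2 huw⟩) := by
    intro u w huw
    simp only [κ, M.edge_vert huw, dif_pos]
    rw [hM.toEdge_eq_of_adj huw]
  have hκ' : ∀ {u w}, M.Adj u w → ∀ x, κ x = κ u → x = u ∨ x = w := by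
    intro u w huw x hx
    rw [hκ huw] at hx
    have hxM : x ∈ M.verts := by
      by_contra hc
      simp [κ, hc] at hx
    obtain ⟨y, hy, -⟩ := hM hxM
    rw [hκ hy, Option.some_inj, e.injective.eq_iff, Subtype.ext_iff, Sym2.eq_iff] at hx
    tauto
  refine ⟨κ ∘ f, fun i => ?_, fun u w => ?_⟩
  · obtain ⟨⟨p, hp⟩, rfl⟩ := e.surjective i
    induction p with
    | _ u w =>
      have hp' : M.Adj u w := hp
      rw [Finset.card_eq_two]
      refine ⟨f.symm u, f.symm w, f.symm.injective.ne hp'.ne, ?_⟩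
      ext x
      simp only [Function.comp_apply, Finset.mem_filter, Finset.mem_univ, true_and,
        Finset.mem_insert, Finset.mem_singleton]
      constructor
      · intro hx
        rw [← hκ hp'] at hx
        refine (hκ' hp' _ hx).imp ?_ ?_ <;> rintro rfl <;> simp
      · rintro (rfl | rfl)
        · simp [hκ hp']
        · simp [hκ hp'.symm, Sym2.eq_swap]
  · rw [← f.map_adj_iff, deleteEdges_adj, top_adj, f.injective.ne_iff, Subgraph.mem_edgeSet]
    refine and_congr_right fun hne => not_congr ⟨fun h => ?_, fun h => ?_⟩
    · simp [hκ h, hκ h.symm, Sym2.eq_swap]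
    · have hv : f u ∈ M.verts := by
        by_contra hc
        exact h.2 (by simp [κ, hc])
      obtain ⟨y, hy, -⟩ := hM hv
      rcases hκ' hy (f w) h.1.symm with e | e
      · exact absurd (f.injective e).symm hne
      · rwa [e]

theorem IsCompleteMinusMatching.nonempty_iso {n k : ℕ} {G H : SimpleGraph (Fin n)}
    (hG : IsCompleteMinusMatching n k G) (hH : IsCompleteMinusMatching n k H) :
    Nonempty (G ≃g H) := by
  obtain ⟨κ, hκ, hκG⟩ := hG.exists_coloring
  obtain ⟨κ', hκ', hκH⟩ := hH.exists_coloring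
  refine nonempty_iso_of_coloring κ κ' (fun c d => ¬ (c = d ∧ c ≠ none)) ?_ hκG hκH
  rintro (_ | i)
  -- The uncoloured vertices are counted as the complement of the `k` colour classes of size two.
  · have h1 := Finset.card_eq_sum_card_fiberwise (f := κ) (s := Finset.univ) (t := Finset.univ)
      (by simp)
    have h2 := Finset.card_eq_sum_card_fiberwise (f := κ') (s := Finset.univ) (t := Finset.univ)
      (by simp)
    rw [Fintype.sum_option] at h1 h2
    simp only [hκ, hκ'] at h1 h2
    omega
  · rw [hκ, hκ']

theorem IsCompleteMinusMatching.ncard_edgeSet {n k : ℕ} {G : SimpleGraph V}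
    (h : IsCompleteMinusMatching n k G) :
    G.edgeSet.ncard + k = (⊤ : SimpleGraph (Fin n)).edgeSet.ncard := by
  obtain ⟨M, -, hk, ⟨f⟩⟩ := h
  rw [Set.ncard_congr' f.mapEdgeSet, edgeSet_deleteEdges, ← hk]
  exact Set.ncard_sdiff_add_ncard_of_subset M.edgeSet_subset

theorem exists_isCompleteMinusMatching {n k : ℕ} (h : 2 * k ≤ n) :
    ∃ G : SimpleGraph (Fin n), IsCompleteMinusMatching n k G := by
  obtain ⟨A, -, hA⟩ := Finset.exists_subset_card_eq (s := (Finset.univ : Finset (Fin n)))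
    (n := 2 * k) (by simpa)
  obtain ⟨M, hMv, hM⟩ := (IsClique.even_iff_exists_isMatching
    (G := (⊤ : SimpleGraph (Fin n))) (u := (A : Set (Fin n))) (fun _ _ _ _ h => h)
    (Set.toFinite _)).1 (by rw [Set.ncard_coe_finset, hA]; simp)
  have := two_mul_ncard_edgeSet hM
  rw [hMv, Set.ncard_coe_finset] at this
  exact ⟨_, M, hM, by omega, ⟨Iso.refl⟩⟩

/-! ### Joins with a star or a triangle, and their isomorphism invariants -/

/-- `G` is the join of `r` isolated vertices and a star with `k` leaves plus isolated vertices. -/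
def IsJoinStar (r k : ℕ) (G : SimpleGraph V) : Prop :=
  ∃ (S L : Finset V) (c : V), S.card = r ∧ L.card = k ∧ c ∉ S ∧ c ∉ L ∧ (∀ x ∈ L, x ∉ S) ∧
    ∀ u w, G.Adj u w ↔ (u ∈ S ∧ w ∉ S) ∨ (u ∉ S ∧ w ∈ S) ∨ (u = c ∧ w ∈ L) ∨ (w = c ∧ u ∈ L)

/-- `G` is the join of `r` isolated vertices and a triangle plus isolated vertices. -/
def IsJoinTriangle (r : ℕ) (G : SimpleGraph V) : Prop :=
  ∃ S T : Finset V, S.card = r ∧ T.card = 3 ∧ (∀ x ∈ T, x ∉ S) ∧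
    ∀ u w, G.Adj u w ↔ (u ∈ S ∧ w ∉ S) ∨ (u ∉ S ∧ w ∈ S) ∨ (u ≠ w ∧ u ∈ T ∧ w ∈ T)

theorem IsJoinStar.nonempty_iso [Fintype V] {r k : ℕ} {G H : SimpleGraph V}
    (hG : IsJoinStar r k G) (hH : IsJoinStar r k H) : Nonempty (G ≃g H) := by
  classical
  have key : ∀ {G : SimpleGraph V}, IsJoinStar r k G →
      ∃ κ : V → Fin 4, (Finset.univ.filter fun v => κ v = 0).card = r ∧
        (Finset.univ.filter fun v => κ v = 1).card = 1 ∧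
        (Finset.univ.filter fun v => κ v = 2).card = k ∧
        ∀ u w, G.Adj u w ↔ u ≠ w ∧ ((κ u = 0 ∧ κ w ≠ 0) ∨ (κ u ≠ 0 ∧ κ w = 0) ∨
          (κ u = 1 ∧ κ w = 2) ∨ (κ w = 1 ∧ κ u = 2)) := by
    rintro G ⟨S, L, c, hS, hL, hcS, hcL, hLS, hadj⟩
    let κ : V → Fin 4 := fun v => if v ∈ S then 0 else if v = c then 1 else if v ∈ L then 2 else 3
    have h0 : ∀ v, κ v = 0 ↔ v ∈ S := by intro v; simp only [κ]; grind
    have h1 : ∀ v, κ v = 1 ↔ v = c := by intro v; simp only [κ]; grind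
    have h2 : ∀ v, κ v = 2 ↔ v ∈ L := by intro v; simp only [κ]; grind
    refine ⟨κ, ?_, ?_, ?_, fun u w => ?_⟩
    · simp [h0, hS]
    · rw [Finset.filter_congr fun v _ => h1 v, Finset.filter_eq' _ c]
      simp
    · simp [h2, hL]
    · simp only [h0, h1, h2, hadj, ne_eq]
      grind
  obtain ⟨κ, a0, a1, a2, hκ⟩ := key hG
  obtain ⟨κ', b0, b1, b2, hκ'⟩ := key hH
  refine nonempty_iso_of_coloring κ κ' (fun x y => (x = 0 ∧ y ≠ 0) ∨ (x ≠ 0 ∧ y = 0) ∨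
    (x = 1 ∧ y = 2) ∨ (y = 1 ∧ x = 2)) ?_ hκ hκ'
  have h1 := Finset.card_eq_sum_card_fiberwise (f := κ) (s := Finset.univ) (t := Finset.univ)
    (by simp)
  have h2 := Finset.card_eq_sum_card_fiberwise (f := κ') (s := Finset.univ) (t := Finset.univ)
    (by simp)
  rw [Fin.sum_univ_four, Finset.card_univ] at h1 h2
  intro i
  fin_cases i <;> simp only [Fin.zero_eta, Fin.mk_one, Fin.reduceFinMk] <;> omega

theorem IsJoinTriangle.nonempty_iso [Fintype V] {r : ℕ} {G H : SimpleGraph V}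
    (hG : IsJoinTriangle r G) (hH : IsJoinTriangle r H) : Nonempty (G ≃g H) := by
  classical
  have key : ∀ {G : SimpleGraph V}, IsJoinTriangle r G →
      ∃ κ : V → Fin 3, (Finset.univ.filter fun v => κ v = 0).card = r ∧
        (Finset.univ.filter fun v => κ v = 1).card = 3 ∧
        ∀ u w, G.Adj u w ↔ u ≠ w ∧ ((κ u = 0 ∧ κ w ≠ 0) ∨ (κ u ≠ 0 ∧ κ w = 0) ∨
          (κ u = 1 ∧ κ w = 1)) := by
    rintro G ⟨S, T, hS, hT, hTS, hadj⟩
    let κ : V → Fin 3 := fun v => if v ∈ S then 0 else if v ∈ T then 1 else 2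
    have h0 : ∀ v, κ v = 0 ↔ v ∈ S := by intro v; simp only [κ]; grind
    have h1 : ∀ v, κ v = 1 ↔ v ∈ T := by intro v; simp only [κ]; grind
    refine ⟨κ, ?_, ?_, fun u w => ?_⟩
    · simp [h0, hS]
    · simp [h1, hT]
    · simp only [h0, h1, hadj, ne_eq]
      grind
  obtain ⟨κ, a0, a1, hκ⟩ := key hG
  obtain ⟨κ', b0, b1, hκ'⟩ := key hH
  refine nonempty_iso_of_coloring κ κ' (fun x y => (x = 0 ∧ y ≠ 0) ∨ (x ≠ 0 ∧ y = 0) ∨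
    (x = 1 ∧ y = 1)) ?_ hκ hκ'
  have h1 := Finset.card_eq_sum_card_fiberwise (f := κ) (s := Finset.univ) (t := Finset.univ)
    (by simp)
  have h2 := Finset.card_eq_sum_card_fiberwise (f := κ') (s := Finset.univ) (t := Finset.univ)
    (by simp)
  rw [Fin.sum_univ_three, Finset.card_univ] at h1 h2
  intro i
  fin_cases i <;> simp only [Fin.zero_eta, Fin.mk_one, Fin.reduceFinMk] <;> omega

theorem exists_isJoinStar {r k : ℕ} (hk : k ≤ r) :
    ∃ G : SimpleGraph (Fin (2 * r + 1)), IsJoinStar r k G := by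
  classical
  obtain ⟨S, -, hS⟩ := Finset.exists_subset_card_eq
    (s := (Finset.univ : Finset (Fin (2 * r + 1)))) (n := r) (by simp; omega)
  have hSc := Finset.card_add_card_compl S
  rw [Fintype.card_fin] at hSc
  obtain ⟨c, hc⟩ : Sᶜ.Nonempty := Finset.card_pos.1 (by omega)
  obtain ⟨L, hLS, hL⟩ := Finset.exists_subset_card_eq (s := Sᶜ.erase c) (n := k) (by
    rw [Finset.card_erase_of_mem hc]; omega)
  have hLS' : ∀ x ∈ L, x ≠ c ∧ x ∉ S := fun x hx => by simpa using hLS hx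
  refine ⟨{ Adj := fun u w => (u ∈ S ∧ w ∉ S) ∨ (u ∉ S ∧ w ∈ S) ∨ (u = c ∧ w ∈ L) ∨
              (w = c ∧ u ∈ L)
            symm := ⟨fun u w h => by tauto⟩
            loopless := ⟨fun u h => by grind⟩ },
    S, L, c, hS, hL, by simpa using hc, fun h => (hLS' c h).1 rfl, fun x hx => (hLS' x hx).2,
    fun u w => Iff.rfl⟩

theorem exists_isJoinTriangle {r : ℕ} (hr : 2 ≤ r) :
    ∃ G : SimpleGraph (Fin (2 * r + 1)), IsJoinTriangle r G := by
  classical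
  obtain ⟨S, -, hS⟩ := Finset.exists_subset_card_eq
    (s := (Finset.univ : Finset (Fin (2 * r + 1)))) (n := r) (by simp; omega)
  have hSc := Finset.card_add_card_compl S
  rw [Fintype.card_fin] at hSc
  obtain ⟨T, hTS, hT⟩ := Finset.exists_subset_card_eq (s := Sᶜ) (n := 3) (by omega)
  refine ⟨{ Adj := fun u w => (u ∈ S ∧ w ∉ S) ∨ (u ∉ S ∧ w ∈ S) ∨ (u ≠ w ∧ u ∈ T ∧ w ∈ T)
            symm := ⟨fun u w h => by grind⟩
            loopless := ⟨fun u h => by grind⟩ },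
    S, T, hS, hT, fun x hx => by simpa using hTS hx, fun u w => Iff.rfl⟩

theorem ncard_neighborSet_iso {W : Type*} {G : SimpleGraph V} {H : SimpleGraph W} (f : G ≃g H)
    (v : V) : (H.neighborSet (f v)).ncard = (G.neighborSet v).ncard :=
  (Set.ncard_congr' (f.mapNeighborSet v)).symm

/-- Only the centre can have degree above `r + 1`: vertices of `S` have `r + 1` neighbours, and
every other vertex has neighbours only in `S ∪ {c}`. -/
theorem IsJoinStar.exists_center [Fintype V] {r k : ℕ} (hcard : Fintype.card V = 2 * r + 1)
    {G : SimpleGraph V} (h : IsJoinStar r k G) : ∃ c, (G.neighborSet c).ncard = r + k ∧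
      ∀ v ≠ c, (G.neighborSet v).ncard ≤ r + 1 := by
  classical
  obtain ⟨S, L, c, hS, hL, hcS, hcL, hLS, hadj⟩ := h
  have hSc := Finset.card_add_card_compl S
  refine ⟨c, ?_, fun v hv => ?_⟩
  · rw [show G.neighborSet c = ((S ∪ L : Finset V) : Set V) by
      ext x
      simp only [mem_neighborSet, hadj, Finset.coe_union, Set.mem_union, Finset.mem_coe]
      grind, Set.ncard_coe_finset, Finset.card_union_of_disjoint, hS, hL]
    exact Finset.disjoint_right.2 hLS
  · have h1 := Finset.card_insert_le c S
    by_cases hvS : v ∈ S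
    · have : (G.neighborSet v).ncard ≤ ((Sᶜ : Finset V) : Set V).ncard := by
        refine Set.ncard_le_ncard (fun x hx => ?_) (Set.toFinite _)
        simp only [mem_neighborSet, hadj, Finset.mem_coe, Finset.mem_compl] at hx ⊢
        grind
      rw [Set.ncard_coe_finset] at this
      omega
    · have : (G.neighborSet v).ncard ≤ ((insert c S : Finset V) : Set V).ncard := by
        refine Set.ncard_le_ncard (fun x hx => ?_) (Set.toFinite _)
        simp only [mem_neighborSet, hadj, Finset.mem_coe, Finset.mem_insert] at hx ⊢
        grind
      rw [Set.ncard_coe_finset] at this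
      omega

theorem IsJoinTriangle.exists_pair [Finite V] {r : ℕ} {G : SimpleGraph V}
    (h : IsJoinTriangle r G) : ∃ s t, s ≠ t ∧ (G.neighborSet s).ncard = r + 2 ∧
      (G.neighborSet t).ncard = r + 2 := by
  classical
  obtain ⟨S, T, hS, hT, hTS, hadj⟩ := h
  have key : ∀ t ∈ T, (G.neighborSet t).ncard = r + 2 := by
    intro t ht
    rw [show G.neighborSet t = ((S ∪ T.erase t : Finset V) : Set V) by
      ext x
      simp only [mem_neighborSet, hadj, Finset.coe_union, Set.mem_union, Finset.mem_coe,
        Finset.mem_erase]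
      grind, Set.ncard_coe_finset, Finset.card_union_of_disjoint, hS,
      Finset.card_erase_of_mem ht, hT]
    exact Finset.disjoint_right.2 fun x hx => hTS x (Finset.mem_of_mem_erase hx)
  obtain ⟨s, t, hs, ht, hst⟩ := Finset.one_lt_card_iff.1 (show 1 < T.card by omega)
  exact ⟨s, t, hst, key s hs, key t ht⟩

theorem not_isAlmostComplete_of_indep {G : SimpleGraph V} {S : Finset V} (hS : 3 ≤ S.card)
    (h : ∀ u ∈ S, ∀ w ∈ S, ¬ G.Adj u w) : ¬ IsAlmostComplete G := by
  intro hG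
  obtain ⟨x, y, z, hx, hy, hz, hxy, hxz, hyz⟩ :=
    Finset.two_lt_card_iff.1 (show 2 < S.card by omega)
  exact (hG x y z hxy hxz hyz).elim (h x hx y hy) (h x hx z hz)

theorem IsJoinStar.not_isAlmostComplete {r k : ℕ} (hr : 3 ≤ r) {G : SimpleGraph V}
    (h : IsJoinStar r k G) : ¬ IsAlmostComplete G := by
  obtain ⟨S, L, c, hS, hL, hcS, hcL, hLS, hadj⟩ := h
  refine not_isAlmostComplete_of_indep (S := S) (by omega) fun u hu w hw => ?_
  rw [hadj]
  grind

theorem IsJoinTriangle.not_isAlmostComplete {r : ℕ} (hr : 3 ≤ r) {G : SimpleGraph V}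
    (h : IsJoinTriangle r G) : ¬ IsAlmostComplete G := by
  obtain ⟨S, T, hS, hT, hTS, hadj⟩ := h
  refine not_isAlmostComplete_of_indep (S := S) (by omega) fun u hu w hw => ?_
  rw [hadj]
  grind

theorem IsJoinStar.eq_of_iso {W : Type*} [Fintype V] [Fintype W] {r j k : ℕ} (hj : 1 ≤ j)
    (hk : 1 ≤ k) {G : SimpleGraph V} {H : SimpleGraph W} (hV : Fintype.card V = 2 * r + 1)
    (hW : Fintype.card W = 2 * r + 1) (hG : IsJoinStar r j G) (hH : IsJoinStar r k H)
    (f : G ≃g H) : j = k := by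
  obtain ⟨c, hc, hc'⟩ := hG.exists_center hV
  obtain ⟨d, hd, hd'⟩ := hH.exists_center hW
  have h1 := ncard_neighborSet_iso f c
  have h2 := ncard_neighborSet_iso f (f.symm d)
  rw [f.apply_symm_apply] at h2
  by_cases h : f c = d
  · subst h
    omega
  -- If the centres do not correspond, both have degree at most `r + 1`, so `j = k = 1`.
  · have h3 := hd' _ h
    have h4 := hc' (f.symm d) fun e => h (by rw [← e, f.apply_symm_apply])
    omega

/-- The triangle gives two vertices of degree `r + 2`, the star at most one of degree above `r + 1`.
-/
theorem IsJoinStar.not_iso_isJoinTriangle {W : Type*} [Fintype V] [Finite W] {r k : ℕ}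
    {G : SimpleGraph V} {H : SimpleGraph W} (hV : Fintype.card V = 2 * r + 1)
    (hG : IsJoinStar r k G) (hH : IsJoinTriangle r H) (f : H ≃g G) : False := by
  obtain ⟨c, hc, hc'⟩ := hG.exists_center hV
  obtain ⟨s, t, hst, hs, ht⟩ := hH.exists_pair
  have h1 := ncard_neighborSet_iso f s
  have h2 := ncard_neighborSet_iso f t
  by_cases h : f s = c
  · have := hc' (f t) fun e => hst (f.injective (h.trans e.symm))
    omega
  · have := hc' (f s) h
    omega

/-! ### Joins are exactly the factor-critical ESE-graphs in 𝒢₂ -/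

theorem isFamilyTwoSet_of_forall_adj [Finite V] {G : SimpleGraph V} {S : Finset V}
    (hS : 3 ≤ S.card) (hadj : ∀ u ∈ S, ∀ w, G.Adj u w ↔ w ∉ S)
    (hm : matchingNumber (G.induce (S : Set V)ᶜ) = 1) : IsFamilyTwoSet G S where
  indep := fun u hu w hw _ huw => (hadj u hu w).1 huw hw
  card := by rwa [Set.ncard_coe_finset]
  complete := fun u hu w hw => (hadj u hu w).2 hw
  matching := hm

theorem IsJoinStar.exists_isFamilyTwoSet [Finite V] {r k : ℕ} (hr : 3 ≤ r) (hk : 1 ≤ k)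
    {G : SimpleGraph V} (h : IsJoinStar r k G) : ∃ S : Finset V, S.card = r ∧
      IsFamilyTwoSet G S ∧ IsStarPlusIsolated k (G.induce (S : Set V)ᶜ) := by
  classical
  obtain ⟨S, L, c, hS, hL, hcS, hcL, hLS, hadj⟩ := h
  refine ⟨S, hS, isFamilyTwoSet_of_forall_adj (by omega) (fun u hu w => ?_) ?_,
    ⟨c, by simpa⟩, L.subtype (· ∈ (S : Set V)ᶜ), by simpa, ?_, ?_⟩
  · rw [hadj]
    grind
  · rw [matchingNumber_induce_compl_eq_one_iff]
    obtain ⟨l, hl⟩ : L.Nonempty := Finset.card_pos.1 (by omega)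
    refine ⟨⟨c, hcS, l, hLS l hl, (hadj c l).2 (by simp [hl])⟩, ?_⟩
    intro x hx y hy z hz t ht hxy hzt hn
    simp only [Finset.mem_coe] at hx hy hz ht
    rw [hadj] at hxy hzt
    simp only [List.nodup_cons, List.mem_cons] at hn
    grind
  · rw [Finset.card_subtype, Finset.filter_true_of_mem (by simpa using hLS), hL]
  · rintro ⟨u, hu⟩ ⟨w, hw⟩
    simp only [Set.mem_compl_iff, Finset.mem_coe] at hu hw
    simp [hadj, hu, hw]

theorem IsJoinTriangle.exists_isFamilyTwoSet [Finite V] {r : ℕ} (hr : 3 ≤ r)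
    {G : SimpleGraph V} (h : IsJoinTriangle r G) : ∃ S : Finset V, S.card = r ∧
      IsFamilyTwoSet G S ∧ IsTrianglePlusIsolated (G.induce (S : Set V)ᶜ) := by
  classical
  obtain ⟨S, T, hS, hT, hTS, hadj⟩ := h
  refine ⟨S, hS, isFamilyTwoSet_of_forall_adj (by omega) (fun u hu w => ?_) ?_,
    T.subtype (· ∈ (S : Set V)ᶜ), ?_, ?_⟩
  · rw [hadj]
    grind
  · rw [matchingNumber_induce_compl_eq_one_iff]
    obtain ⟨s, t, hs, ht, hst⟩ := Finset.one_lt_card_iff.1 (show 1 < T.card by omega)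
    refine ⟨⟨s, hTS s hs, t, hTS t ht, (hadj s t).2 (by simp [hs, ht, hst])⟩, ?_⟩
    intro x hx y hy z hz t ht hxy hzt hn
    simp only [Finset.mem_coe] at hx hy hz ht
    rw [hadj] at hxy hzt
    have hsub : [x, y, z, t].toFinset ⊆ T := by
      simp only [List.toFinset_cons, List.toFinset_nil, Finset.insert_subset_iff]
      grind
    have := Finset.card_le_card hsub
    rw [List.toFinset_card_of_nodup hn, hT] at this
    simp at this
  · rw [Finset.card_subtype, Finset.filter_true_of_mem (by simpa using hTS), hT]
  · rintro ⟨u, hu⟩ ⟨w, hw⟩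
    simp only [Set.mem_compl_iff, Finset.mem_coe] at hu hw
    simp [hadj, hu, hw]

theorem IsFamilyTwoSet.isJoinStar {r k : ℕ} {G : SimpleGraph V} {S : Finset V}
    (h : IsFamilyTwoSet G S) (hS : S.card = r)
    (hk : IsStarPlusIsolated k (G.induce (S : Set V)ᶜ)) : IsJoinStar r k G := by
  obtain ⟨⟨c, hc⟩, L, hcL, hL, hadj⟩ := hk
  refine ⟨S, L.map (Function.Embedding.subtype _), c, hS, by simpa, by simpa using hc,
    by simpa using fun _ => hcL, ?_, fun u w => ?_⟩
  · simp +contextual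
  have h1 := fun hu hw huw => h.indep (x := u) (y := w) hu hw (G.ne_of_adj huw) huw
  have h2 := h.complete u
  have h3 := h.complete w
  simp only [Finset.mem_coe] at h1 h2 h3
  have h4 : ∀ x, x ∈ L.map (Function.Embedding.subtype _) ↔
      ∃ hx : x ∈ (S : Set V)ᶜ, (⟨x, hx⟩ : ((S : Set V)ᶜ : Set V)) ∈ L := by simp
  simp only [h4]
  have hc' : c ∉ S := by simpa using hc
  by_cases hu : u ∈ S
  · by_cases hw : w ∈ S
    · have : u ≠ c := by rintro rfl; exact hc' hu
      have : w ≠ c := by rintro rfl; exact hc' hw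
      simp only [hu, hw]
      tauto
    · simp [hu, hw, h2 hu w hw]
  · by_cases hw : w ∈ S
    · simp [hu, hw, (h3 hw u hu).symm]
    · have := hadj ⟨u, by simpa⟩ ⟨w, by simpa⟩
      simp only [comap_adj, Function.Embedding.subtype_apply, Subtype.mk.injEq] at this
      rw [this]
      simp [hu, hw]

theorem IsFamilyTwoSet.isJoinTriangle {r : ℕ} {G : SimpleGraph V} {S : Finset V}
    (h : IsFamilyTwoSet G S) (hS : S.card = r)
    (hk : IsTrianglePlusIsolated (G.induce (S : Set V)ᶜ)) : IsJoinTriangle r G := by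
  obtain ⟨T, hT, hadj⟩ := hk
  refine ⟨S, T.map (Function.Embedding.subtype _), hS, by simpa, by simp +contextual,
    fun u w => ?_⟩
  have h1 := fun hu hw huw => h.indep (x := u) (y := w) hu hw (G.ne_of_adj huw) huw
  have h2 := h.complete u
  have h3 := h.complete w
  simp only [Finset.mem_coe] at h1 h2 h3
  have h4 : ∀ x, x ∈ T.map (Function.Embedding.subtype _) ↔
      ∃ hx : x ∈ (S : Set V)ᶜ, (⟨x, hx⟩ : ((S : Set V)ᶜ : Set V)) ∈ T := by simp
  simp only [h4]
  by_cases hu : u ∈ S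
  · by_cases hw : w ∈ S
    · simp only [hu, hw, Set.mem_compl_iff, Finset.mem_coe]
      grind
    · simp [hu, hw, h2 hu w hw]
  · by_cases hw : w ∈ S
    · simp [hu, hw, (h3 hw u hu).symm]
    · have := hadj ⟨u, by simpa⟩ ⟨w, by simpa⟩
      simp only [comap_adj, Function.Embedding.subtype_apply, ne_eq, Subtype.mk.injEq] at this
      rw [this]
      simp [hu, hw]

theorem exists_coe_eq [Finite V] (S : Set V) : ∃ T : Finset V, (T : Set V) = S :=
  ⟨(Set.toFinite S).toFinset, by simp⟩

/-- The structure of a factor-critical graph with a set as in the definition of `𝒢₂`. -/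
theorem IsFamilyTwoSet.structure [Fintype V] {G : SimpleGraph V} (hfc : IsFactorCritical G)
    {r : ℕ} (hcard : Fintype.card V = 2 * r + 1) {S : Set V} (h : IsFamilyTwoSet G S) :
    S.ncard = r ∧ ((∃ k, 1 ≤ k ∧ k ≤ r ∧ IsStarPlusIsolated k (G.induce Sᶜ)) ∨
      IsTrianglePlusIsolated (G.induce Sᶜ)) := by
  classical
  obtain ⟨S, rfl⟩ := exists_coe_eq S
  have hS := h.card_eq hfc hcard
  rw [Set.ncard_coe_finset]
  refine ⟨hS, ?_⟩
  have hSc := Finset.card_add_card_compl S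
  -- A star in the complement has fewer leaves than these `r + 1` vertices, hence at most `r`.
  have hc : Fintype.card ((S : Set V)ᶜ : Set V) = r + 1 := by
    rw [Fintype.card_congr (Equiv.subtypeEquivRight (q := (· ∈ Sᶜ)) (by simp)),
      Fintype.card_coe]
    omega
  refine (isStarPlusIsolated_or_isTrianglePlusIsolated h.matching).imp_left ?_
  rintro ⟨k, h1, h2, h3⟩
  exact ⟨k, h1, by omega, h3⟩

theorem isESE_isJoinStar_iff [Fintype V] {r k : ℕ} (hr : 3 ≤ r) (hk : 1 ≤ k)
    (hcard : Fintype.card V = 2 * r + 1) {G : SimpleGraph V} :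
    (IsFactorCritical G ∧ IsESE G ∧ ∃ S : Set V, IsFamilyTwoSet G S ∧
      IsStarPlusIsolated k (G.induce Sᶜ)) ↔ IsJoinStar r k G := by
  constructor
  · rintro ⟨hfc, -, S, hS, hk⟩
    obtain ⟨S, rfl⟩ := exists_coe_eq S
    exact hS.isJoinStar (hS.card_eq hfc hcard) hk
  · intro h
    obtain ⟨S, rfl, hS, hk⟩ := h.exists_isFamilyTwoSet hr hk
    exact ⟨hS.isFactorCritical hcard, hS.isESE hcard, S, hS, hk⟩

theorem isESE_isJoinTriangle_iff [Fintype V] {r : ℕ} (hr : 3 ≤ r)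
    (hcard : Fintype.card V = 2 * r + 1) {G : SimpleGraph V} :
    (IsFactorCritical G ∧ IsESE G ∧ ∃ S : Set V, IsFamilyTwoSet G S ∧
      IsTrianglePlusIsolated (G.induce Sᶜ)) ↔ IsJoinTriangle r G := by
  constructor
  · rintro ⟨hfc, -, S, hS, hk⟩
    obtain ⟨S, rfl⟩ := exists_coe_eq S
    exact hS.isJoinTriangle (hS.card_eq hfc hcard) hk
  · intro h
    obtain ⟨S, rfl, hS, hk⟩ := h.exists_isFamilyTwoSet hr
    exact ⟨hS.isFactorCritical hcard, hS.isESE hcard, S, hS, hk⟩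

theorem isESE_isFamilyTwo_iff [Fintype V] {r : ℕ} (hr : 3 ≤ r)
    (hcard : Fintype.card V = 2 * r + 1) {G : SimpleGraph V} :
    (IsFactorCritical G ∧ IsESE G ∧ IsFamilyTwo G) ↔
      (∃ k ∈ Finset.Icc 1 r, IsJoinStar r k G) ∨ IsJoinTriangle r G := by
  constructor
  · rintro ⟨hfc, hG, S, hS⟩
    rcases (hS.structure hfc hcard).2 with ⟨k, hk, hkr, h⟩ | h
    · exact Or.inl ⟨k, Finset.mem_Icc.2 ⟨hk, hkr⟩,
        (isESE_isJoinStar_iff hr hk hcard).1 ⟨hfc, hG, S, hS, h⟩⟩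
    · exact Or.inr ((isESE_isJoinTriangle_iff hr hcard).1 ⟨hfc, hG, S, hS, h⟩)
  · rintro (⟨k, hk, h⟩ | h)
    · obtain ⟨hfc, hG, S, hS, -⟩ :=
        (isESE_isJoinStar_iff hr (Finset.mem_Icc.1 hk).1 hcard).2 h
      exact ⟨hfc, hG, S, hS⟩
    · obtain ⟨hfc, hG, S, hS, -⟩ := (isESE_isJoinTriangle_iff hr hcard).2 h
      exact ⟨hfc, hG, S, hS⟩

theorem IsCompleteMinusMatching.isFactorCritical_and_isESE [Fintype V] {r n k : ℕ} (hr : 3 ≤ r)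
    (hcard : Fintype.card V = 2 * r + 1) {G : SimpleGraph V}
    (h : IsCompleteMinusMatching n k G) : IsFactorCritical G ∧ IsESE G :=
  ⟨h.isAlmostComplete.isFactorCritical (by omega) hcard, h.isAlmostComplete.isESE ⟨r, hcard⟩⟩

theorem IsCompleteMinusMatching.le {r k : ℕ} {G : SimpleGraph V}
    (h : IsCompleteMinusMatching (2 * r + 1) k G) : k ≤ r := by
  obtain ⟨M, hM, hk, -⟩ := h
  have h1 := two_mul_ncard_edgeSet hM
  have h2 := Set.ncard_le_card M.verts
  rw [Nat.card_eq_fintype_card, Fintype.card_fin] at h2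
  omega

theorem isFamilyOne_iff {r : ℕ} (hr : 3 ≤ r) {G : SimpleGraph (Fin (2 * r + 1))} :
    IsFamilyOne G ↔ ∃ k ∈ Finset.Icc 1 r, IsCompleteMinusMatching (2 * r + 1) k G := by
  constructor
  · rintro ⟨s, k, -, hk, h⟩
    obtain ⟨_, -, -, ⟨f⟩⟩ := id h
    have := Fintype.card_congr f.toEquiv
    simp only [Fintype.card_fin] at this
    obtain rfl : s = r := by omega
    exact ⟨k, Finset.mem_Icc.2 ⟨hk, h.le⟩, h⟩
  · rintro ⟨k, hk, h⟩
    exact ⟨r, k, hr, (Finset.mem_Icc.1 hk).1, h⟩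

/-! ### Counting the isomorphism classes -/

/-- The isomorphism classes of factor-critical ESE-graphs: complete graphs without a matching of
given size, joins with a star of given size, and the join with a triangle. -/
def IsClass (r : ℕ) : ℕ ⊕ ℕ ⊕ Unit → SimpleGraph (Fin (2 * r + 1)) → Prop
  | .inl k, G => IsCompleteMinusMatching (2 * r + 1) k G
  | .inr (.inl k), G => IsJoinStar r k G
  | .inr (.inr _), G => IsJoinTriangle r G

/-- The indices of the nonempty, pairwise distinct classes. -/
def classIndices (r : ℕ) : Finset (ℕ ⊕ ℕ ⊕ Unit) :=
  -- Matching sizes start at 0, which is the complete graph; stars start at one leaf, because the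
  -- complement of `S` must contain an edge.
  (Finset.range (r + 1)).disjSum ((Finset.Icc 1 r).disjSum Finset.univ)

theorem isClass_nonempty_iso {r : ℕ} {i : ℕ ⊕ ℕ ⊕ Unit} {G H : SimpleGraph (Fin (2 * r + 1))}
    (hG : IsClass r i G) (hH : IsClass r i H) : Nonempty (G ≃g H) := by
  rcases i with k | k | k
  · exact IsCompleteMinusMatching.nonempty_iso hG hH
  · exact IsJoinStar.nonempty_iso hG hH
  · exact IsJoinTriangle.nonempty_iso hG hH

theorem exists_isClass {r : ℕ} (hr : 3 ≤ r) {i : ℕ ⊕ ℕ ⊕ Unit} (hi : i ∈ classIndices r) :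
    ∃ G, IsClass r i G := by
  rcases i with k | k | -
  · refine exists_isCompleteMinusMatching ?_
    simp [classIndices] at hi
    omega
  · refine exists_isJoinStar ?_
    simp [classIndices] at hi
    omega
  · exact exists_isJoinTriangle (by omega)

/-- Matching sizes are read off from edge numbers; joins are not almost complete, as `S` has three
independent vertices; degrees tell the joins apart. -/
theorem isClass_eq_of_iso {r : ℕ} (hr : 3 ≤ r) {i j : ℕ ⊕ ℕ ⊕ Unit} (hi : i ∈ classIndices r)
    (hj : j ∈ classIndices r) {G H : SimpleGraph (Fin (2 * r + 1))} (hG : IsClass r i G)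
    (hH : IsClass r j H) (f : G ≃g H) : i = j := by
  have hn : Fintype.card (Fin (2 * r + 1)) = 2 * r + 1 := Fintype.card_fin _
  rcases i with k | k | ⟨⟩ <;> rcases j with l | l | ⟨⟩ <;>
    simp only [IsClass, classIndices, Finset.inl_mem_disjSum, Finset.inr_mem_disjSum,
      Finset.mem_Icc] at hG hH hi hj
  · have h1 := hG.ncard_edgeSet
    have h2 := hH.ncard_edgeSet
    rw [Set.ncard_congr' f.mapEdgeSet] at h1
    congr 1
    omega
  · exact (hH.not_isAlmostComplete hr (hG.isAlmostComplete.of_iso f.symm)).elim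
  · exact (hH.not_isAlmostComplete hr (hG.isAlmostComplete.of_iso f.symm)).elim
  · exact (hG.not_isAlmostComplete hr (hH.isAlmostComplete.of_iso f)).elim
  · rw [hG.eq_of_iso hi.1 hj.1 hn hn hH f]
  · exact (hG.not_iso_isJoinTriangle hn hH f.symm).elim
  · exact (hG.not_isAlmostComplete hr (hH.isAlmostComplete.of_iso f)).elim
  · exact (hH.not_iso_isJoinTriangle hn hG f).elim
  · rfl

/-- A property that holds exactly for the graphs in some of the classes holds for as many graphs
up to isomorphism as there are classes. -/
theorem numUpToIso_eq_card {r : ℕ} (hr : 3 ≤ r) {P : SimpleGraph (Fin (2 * r + 1)) → Prop}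
    {I : Finset (ℕ ⊕ ℕ ⊕ Unit)} (hI : I ⊆ classIndices r)
    (hP : ∀ G, P G ↔ ∃ i ∈ I, IsClass r i G) : numUpToIso (2 * r + 1) P = I.card := by
  have hex : ∀ i : I, ∃ G, IsClass r i G := fun i => exists_isClass hr (hI i.2)
  choose g hg using hex
  have hinj : Function.Injective fun i => Quotient.mk (isoSetoid (2 * r + 1)) (g i) := by
    intro i j hij
    obtain ⟨f⟩ : Nonempty (g i ≃g g j) := Quotient.exact hij
    exact Subtype.ext (isClass_eq_of_iso hr (hI i.2) (hI j.2) (hg i) (hg j) f)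
  have himage : Quotient.mk (isoSetoid (2 * r + 1)) '' {G | P G} =
      Set.range fun i => Quotient.mk (isoSetoid (2 * r + 1)) (g i) := by
    ext q
    constructor
    · rintro ⟨G, hG, rfl⟩
      obtain ⟨i, hi, hGi⟩ := (hP G).1 hG
      exact ⟨⟨i, hi⟩, Quotient.sound (isClass_nonempty_iso (hg ⟨i, hi⟩) hGi)⟩
    · rintro ⟨i, rfl⟩
      exact ⟨g i, (hP _).2 ⟨i, i.2, hg i⟩, rfl⟩
  rw [numUpToIso, himage, ← Nat.card_coe_set_eq, Nat.card_range_of_injective hinj,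
    Nat.card_eq_fintype_card, Fintype.card_coe]

/-- The classification of factor-critical ESE-graphs. -/
theorem isFactorCritical_and_isESE_iff {r : ℕ} (hr : 3 ≤ r) {G : SimpleGraph (Fin (2 * r + 1))} :
    IsFactorCritical G ∧ IsESE G ↔ ∃ i ∈ classIndices r, IsClass r i G := by
  have hn : Fintype.card (Fin (2 * r + 1)) = 2 * r + 1 := Fintype.card_fin _
  simp only [Sum.exists, classIndices, Finset.inl_mem_disjSum, Finset.inr_mem_disjSum, IsClass,
    Finset.mem_range, Finset.mem_univ, true_and, exists_const, Nat.lt_succ_iff]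
  rw [← isESE_isFamilyTwo_iff hr hn]
  constructor
  · rintro ⟨hfc, hG⟩
    rcases isAlmostComplete_or_isFamilyTwo hfc hG (by omega) with h | h
    · exact Or.inl h.exists_isCompleteMinusMatching
    · exact Or.inr ⟨hfc, hG, h⟩
  · rintro (⟨k, -, h⟩ | h)
    · exact h.isFactorCritical_and_isESE hr hn
    · exact ⟨h.1, h.2.1⟩

theorem IsCompleteMinusMatching.eq_top {n : ℕ} {G : SimpleGraph (Fin n)}
    (h : IsCompleteMinusMatching n 0 G) : G = ⊤ := by
  obtain ⟨M, -, hk, ⟨f⟩⟩ := h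
  rw [Set.ncard_eq_zero] at hk
  have he : ∀ e, e ∉ M.edgeSet := by simp [hk]
  ext u w
  rw [← f.map_adj_iff, deleteEdges_adj]
  simp only [he, not_false_eq_true, and_true, top_adj, f.injective.ne_iff]

end EdgeStable

open EdgeStable in
theorem mainTheorem6 (r : ℕ) (hr : 3 ≤ r) :
    -- exactly `2r+2` factor-critical ESE-graphs on `2r+1` vertices, up to isomorphism
    EdgeStable.numUpToIso (2 * r + 1)
      (fun G => EdgeStable.IsFactorCritical G ∧ EdgeStable.IsESE G) = 2 * r + 2 ∧
    -- each of them is `K_{2r+1}` or belongs to `𝒢₁` or to `𝒢₂`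
    (∀ G : SimpleGraph (Fin (2 * r + 1)),
      EdgeStable.IsFactorCritical G → EdgeStable.IsESE G →
        G = ⊤ ∨ EdgeStable.IsFamilyOne G ∨ EdgeStable.IsFamilyTwo G) ∧
    -- `K_{2r+1}` is one of them
    (EdgeStable.IsFactorCritical (⊤ : SimpleGraph (Fin (2 * r + 1))) ∧
      EdgeStable.IsESE (⊤ : SimpleGraph (Fin (2 * r + 1)))) ∧
    -- `r` of them are in `𝒢₁`, one for each size of the removed matching
    EdgeStable.numUpToIso (2 * r + 1)
      (fun G => EdgeStable.IsFactorCritical G ∧ EdgeStable.IsESE G ∧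
        EdgeStable.IsFamilyOne G) = r ∧
    (∀ k : ℕ, 1 ≤ k → k ≤ r → EdgeStable.numUpToIso (2 * r + 1)
      (fun G => EdgeStable.IsFactorCritical G ∧ EdgeStable.IsESE G ∧
        EdgeStable.IsCompleteMinusMatching (2 * r + 1) k G) = 1) ∧
    -- `r+1` of them are in `𝒢₂`
    EdgeStable.numUpToIso (2 * r + 1)
      (fun G => EdgeStable.IsFactorCritical G ∧ EdgeStable.IsESE G ∧
        EdgeStable.IsFamilyTwo G) = r + 1 ∧
    -- in these, `S` has `r` vertices and the rest induces a star or a triangle,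
    -- plus isolated vertices
    (∀ G : SimpleGraph (Fin (2 * r + 1)),
      EdgeStable.IsFactorCritical G → EdgeStable.IsESE G →
        ∀ S : Set (Fin (2 * r + 1)), EdgeStable.IsFamilyTwoSet G S →
          S.ncard = r ∧
            ((∃ k : ℕ, 1 ≤ k ∧ k ≤ r ∧ EdgeStable.IsStarPlusIsolated k (G.induce Sᶜ)) ∨
              EdgeStable.IsTrianglePlusIsolated (G.induce Sᶜ))) ∧
    -- one for each number of leaves of the star, and one for the triangle
    (∀ k : ℕ, 1 ≤ k → k ≤ r → EdgeStable.numUpToIso (2 * r + 1)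
      (fun G => EdgeStable.IsFactorCritical G ∧ EdgeStable.IsESE G ∧
        ∃ S : Set (Fin (2 * r + 1)), EdgeStable.IsFamilyTwoSet G S ∧
          EdgeStable.IsStarPlusIsolated k (G.induce Sᶜ)) = 1) ∧
    EdgeStable.numUpToIso (2 * r + 1)
      (fun G => EdgeStable.IsFactorCritical G ∧ EdgeStable.IsESE G ∧
        ∃ S : Set (Fin (2 * r + 1)), EdgeStable.IsFamilyTwoSet G S ∧
          EdgeStable.IsTrianglePlusIsolated (G.induce Sᶜ)) = 1 := by
  have hn : Fintype.card (Fin (2 * r + 1)) = 2 * r + 1 := Fintype.card_fin _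
  have hI : classIndices r =
    (Finset.range (r + 1)).disjSum ((Finset.Icc 1 r).disjSum Finset.univ) := rfl
  have htop : IsAlmostComplete (⊤ : SimpleGraph (Fin (2 * r + 1))) := fun v u w hvu _ _ =>
    Or.inl hvu
  refine ⟨?_, ?_, ⟨htop.isFactorCritical (by omega) hn, htop.isESE ⟨r, hn⟩⟩, ?_, ?_, ?_, ?_,
    ?_, ?_⟩
  · rw [numUpToIso_eq_card hr subset_rfl fun G => isFactorCritical_and_isESE_iff hr]
    simp [hI]
    omega
  · intro G hfc hG
    rcases isAlmostComplete_or_isFamilyTwo hfc hG (by omega) with h | h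
    · obtain ⟨k, hk, h⟩ := h.exists_isCompleteMinusMatching
      rcases Nat.eq_zero_or_pos k with rfl | hk0
      · exact Or.inl h.eq_top
      · exact Or.inr (Or.inl ⟨r, k, hr, hk0, h⟩)
    · exact Or.inr (Or.inr h)
  -- Index 0 is left out because 𝒢₁ requires a nonempty matching.
  · rw [numUpToIso_eq_card hr (I := (Finset.Icc 1 r).map .inl)]
    · simp
    · intro i
      simp only [Finset.mem_map, Finset.mem_Icc, hI]
      rintro ⟨k, hk, rfl⟩
      simp
      omega
    · intro G
      simp only [Finset.mem_map, exists_exists_and_eq_and, isFamilyOne_iff hr]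
      constructor
      · rintro ⟨-, -, h⟩
        exact h
      · rintro ⟨k, hk, h⟩
        exact and_assoc.1 ⟨IsCompleteMinusMatching.isFactorCritical_and_isESE hr hn h, k, hk, h⟩
  · intro k hk hkr
    rw [numUpToIso_eq_card hr (I := {.inl k}) (by simp [hI]; omega), Finset.card_singleton]
    intro G
    simp only [Finset.mem_singleton, exists_eq_left, IsClass]
    exact ⟨fun h => h.2.2, fun h => and_assoc.1 ⟨h.isFactorCritical_and_isESE hr hn, h⟩⟩
  · rw [numUpToIso_eq_card hr (I := ((Finset.Icc 1 r).disjSum Finset.univ).map .inr)]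
    · simp
    · intro i
      simp only [Finset.mem_map, hI]
      rintro ⟨k, hk, rfl⟩
      simpa using hk
    · intro G
      rw [isESE_isFamilyTwo_iff hr hn]
      simp [IsClass]
  · exact fun G hfc _ S hS => hS.structure hfc hn
  · intro k hk hkr
    rw [numUpToIso_eq_card hr (I := {.inr (.inl k)}) (by simp [hI]; omega), Finset.card_singleton]
    intro G
    rw [isESE_isJoinStar_iff hr hk hn]
    simp [IsClass]
  · rw [numUpToIso_eq_card hr (I := {.inr (.inr ())}) (by simp [hI]), Finset.card_singleton]
    intro G
    rw [isESE_isJoinTriangle_iff hr hn]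
    simp [IsClass]
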